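/- Let $M$ be a smooth (finite-dimensional, Hausdorff, second countable) manifold and let $\Pi$ be a regular Poisson bivector on $M$: a smooth antisymmetric section of $TM\otimes TM$ of constant rank such that $\{f,g\}=\Pi(df,dg)$ satisfies the Jacobi identity on $C^\infty(M)$. Write $\Pi^\sharp:T^*M\to TM$, $\beta(\Pi^\sharp\alpha)=\Pi(\alpha,\beta)$, and let $T\mathcal S=\Pi^\sharp(T^*M)\subset TM$ be the symplectic distribution, i.e. the subbundle of vectors tangent to the symplectic leaves. Then there is a Poisson connection on $(M,\Pi)$, that is, a smooth leafwise connection $$\nabla:\Gamma^\infty(T\mathcal S)\to\Gamma^\infty(T\mathcal S\otimes T^*\mathcal S)$$ with $\nabla\Pi=0$. Here $\nabla$ is a map $(X,Y)\mapsto\nabla_XY$ from $\Gamma^\infty(T\mathcal S)\times\Gamma^\infty(T\mathcal S)$ to $\Gamma^\infty(T\mathcal S)$ that is $C^\infty(M)$-linear in $X$, additive in $Y$, and satisfies $\nabla_X(fY)=f\nabla_XY+(Xf)Y$; and $\nabla\Pi=0$ means that $$X(\Pi(\alpha,\beta))=\Pi(\nabla_X\alpha,\beta)+\Pi(\alpha,\nabla_X\beta)$$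 for all $X\in\Gamma^\infty(T\mathcal S)$ and $\alpha,\beta\in\Gamma^\infty(T^*\mathcal S)$, where $(\nabla_X\alpha)(Y)=X(\alpha(Y))-\alpha(\nabla_XY)$. Moreover, if a compact Lie group $G$ acts smoothly on $M$ by Poisson maps, then there is a Poisson connection $\nabla$ that is $G$-invariant: $g_*(\nabla_XY)=\nabla_{g_*X}(g_*Y)$ for all $g\in G$ and $X,Y\in\Gamma^\infty(T\mathcal S)$. -/

import Mathlib

open Bundle
open scoped Manifold ContDiff

noncomputable section

namespace RegularPoisson

section Defs

variable (E : Type*) [NormedAddCommGroup E] [NormedSpace ℝ E]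
  (M : Type*) [TopologicalSpace M] [ChartedSpace E M]

/-- The cotangent space `T*_x M`. -/
abbrev Cotangent (x : M) : Type _ := TangentSpace 𝓘(ℝ, E) x →L[ℝ] ℝ

variable {M}

/-- The differential `df_x ∈ T*_x M` of a function `f : M → ℝ`. -/
def differential (f : M → ℝ) (x : M) : Cotangent E M x :=
  (mfderiv 𝓘(ℝ, E) 𝓘(ℝ, ℝ) f x : TangentSpace 𝓘(ℝ, E) x →L[ℝ] ℝ)

variable (M) [IsManifold 𝓘(ℝ, E) ∞ M]

/-- Smooth `1`-forms on `M`, that is, smooth sections of `T*M`. -/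
abbrev OneForm : Type _ :=
  ContMDiffSection 𝓘(ℝ, E) (E →L[ℝ] ℝ) ∞ (fun x : M ↦ Cotangent E M x)

/-- A smooth bivector field `Π` on `M`. The element `Π x` of `T_x M ⊗ T_x M` is recorded as the
linear map `Π♯ : T*_x M → T_x M`, `Π♯ α = Π(α, ·)`, so that `Π(α, β) = β (Π♯ α)`. -/
structure Bivector where
  /-- The linear map `Π♯` at `x`. -/
  sharp : ∀ x : M, Cotangent E M x →L[ℝ] TangentSpace 𝓘(ℝ, E) x
  contMDiff_sharp : ContMDiff 𝓘(ℝ, E) (𝓘(ℝ, E).prod 𝓘(ℝ, (E →L[ℝ] ℝ) →L[ℝ] E)) ∞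
    (fun x ↦ TotalSpace.mk' ((E →L[ℝ] ℝ) →L[ℝ] E)
      (E := fun x : M ↦ Cotangent E M x →L[ℝ] TangentSpace 𝓘(ℝ, E) x) x (sharp x))
  antisymm : ∀ (x : M) (α β : Cotangent E M x), β (sharp x α) = -α (sharp x β)

variable {E M}

namespace Bivector

variable (P : Bivector E M)

/-- The contraction `Π(α, β)` at the point `x`. -/
def pairing (x : M) (α β : Cotangent E M x) : ℝ := β (P.sharp x α)

/-- The bracket `{f, g} = Π(df, dg)`. -/
def bracket (f g : M → ℝ) : M → ℝ :=
  fun x ↦ P.pairing x (differential E f x) (differential E g x)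

/-- `Π` is a Poisson bivector: its bracket satisfies the Jacobi identity on `C^∞(M)`. -/
def IsPoisson : Prop :=
  ∀ f g h : M → ℝ, ContMDiff 𝓘(ℝ, E) 𝓘(ℝ, ℝ) ∞ f → ContMDiff 𝓘(ℝ, E) 𝓘(ℝ, ℝ) ∞ g →
    ContMDiff 𝓘(ℝ, E) 𝓘(ℝ, ℝ) ∞ h → ∀ x : M,
      P.bracket (P.bracket f g) h x + P.bracket (P.bracket h f) g x
        + P.bracket (P.bracket g h) f x = 0

/-- `Π` is regular: its rank is constant on `M`. -/
def IsRegular : Prop :=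
  ∃ r : ℕ, ∀ x : M, Module.finrank ℝ (LinearMap.range (P.sharp x).toLinearMap) = r

/-- The fibre at `x` of the symplectic distribution `TS`: the image of `Π♯` at `x`, which is the
tangent space at `x` of the symplectic leaf through `x`. -/
def leafTangent (x : M) : Submodule ℝ (TangentSpace 𝓘(ℝ, E) x) :=
  LinearMap.range (P.sharp x).toLinearMap

/-- A map `φ : M → M` is a Poisson map for `Π`: it is smooth and `φ^* : C^∞(M) → C^∞(M)`
preserves the Poisson bracket. -/
def IsPoissonMap (φ : M → M) : Prop :=
  ContMDiff 𝓘(ℝ, E) 𝓘(ℝ, E) ∞ φ ∧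
    ∀ f g : M → ℝ, ContMDiff 𝓘(ℝ, E) 𝓘(ℝ, ℝ) ∞ f → ContMDiff 𝓘(ℝ, E) 𝓘(ℝ, ℝ) ∞ g →
      P.bracket (f ∘ φ) (g ∘ φ) = P.bracket f g ∘ φ

end Bivector

/-- The space `Γ^∞(TS)`: smooth vector fields on `M` tangent to the symplectic distribution. -/
@[ext]
structure LeafField (P : Bivector E M) where
  /-- The underlying vector field. -/
  toFun : ∀ x : M, TangentSpace 𝓘(ℝ, E) x
  contMDiff : ContMDiff 𝓘(ℝ, E) 𝓘(ℝ, E).tangent ∞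
    (fun x ↦ (⟨x, toFun x⟩ : TangentBundle 𝓘(ℝ, E) M))
  mem : ∀ x, toFun x ∈ P.leafTangent x

namespace LeafField

variable {P : Bivector E M}

instance : CoeFun (LeafField P) (fun _ ↦ ∀ x : M, TangentSpace 𝓘(ℝ, E) x) := ⟨toFun⟩

instance : Add (LeafField P) where
  add X Y :=
    { toFun := fun x ↦ X x + Y x
      contMDiff := X.contMDiff.add_section Y.contMDiff
      mem := fun x ↦ (P.leafTangent x).add_mem (X.mem x) (Y.mem x) }

instance : SMul C^∞⟮𝓘(ℝ, E), M; ℝ⟯ (LeafField P) where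
  smul f X :=
    { toFun := fun x ↦ f x • X x
      contMDiff := f.contMDiff.smul_section X.contMDiff
      mem := fun x ↦ (P.leafTangent x).smul_mem (f x) (X.mem x) }

end LeafField

/-- The section `Π♯ α` of `TS` obtained by contracting `Π` with a `1`-form `α`. -/
def Bivector.sharpForm (P : Bivector E M) (α : OneForm E M) : LeafField P where
  toFun x := P.sharp x (α x)
  contMDiff := ContMDiff.clm_bundle_apply (F₁ := E →L[ℝ] ℝ) (F₂ := E)
    P.contMDiff_sharp α.contMDiff
  mem x := ⟨α x, rfl⟩

/-- A smooth connection `∇ : Γ^∞(TS) → Γ^∞(TS ⊗ T*S)` on the symplectic distribution,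
differentiating along `TS` only, written as a map `(X, Y) ↦ ∇_X Y`. -/
structure LeafConnection (P : Bivector E M) where
  /-- The covariant derivative `∇_X Y`. -/
  nabla : LeafField P → LeafField P → LeafField P
  add_left : ∀ X X' Y, nabla (X + X') Y = nabla X Y + nabla X' Y
  smul_left : ∀ (f : C^∞⟮𝓘(ℝ, E), M; ℝ⟯) X Y, nabla (f • X) Y = f • nabla X Y
  add_right : ∀ X Y Y', nabla X (Y + Y') = nabla X Y + nabla X Y'
  leibniz : ∀ (f : C^∞⟮𝓘(ℝ, E), M; ℝ⟯) X Y (x : M),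
    nabla X (f • Y) x = f x • nabla X Y x + differential E f x (X x) • Y x

namespace LeafConnection

variable {P : Bivector E M} (D : LeafConnection P)

/-- The dual connection on `T*S`, applied to the restriction of a `1`-form `α` to `TS`:
`(∇_X α)(Y) = X(α(Y)) - α(∇_X Y)`. -/
def nablaForm (X : LeafField P) (α : OneForm E M) (Y : LeafField P) (x : M) : ℝ :=
  differential E (fun y ↦ α y (Y y)) x (X x) - α x (D.nabla X Y x)

/-- The covariant derivative of `Π` as a section of `TS ⊗ TS`:
`(∇_X Π)(α, β) = X(Π(α, β)) - Π(∇_X α, β) - Π(α, ∇_X β)`.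
Here `Π(α, ∇_X β) = (∇_X β)(Π♯ α)` and `Π(∇_X α, β) = -Π(β, ∇_X α) = -(∇_X α)(Π♯ β)`. -/
def nablaBivector (X : LeafField P) (α β : OneForm E M) (x : M) : ℝ :=
  differential E (fun y ↦ P.pairing y (α y) (β y)) x (X x)
    - (-D.nablaForm X α (P.sharpForm β) x) - D.nablaForm X β (P.sharpForm α) x

/-- `∇` is a Poisson connection: `∇ Π = 0`. Every section of `T*S` is the restriction of a
`1`-form on `M`, so it suffices to evaluate on `1`-forms on `M`. -/
def IsPoissonConnection : Prop :=
  ∀ (X : LeafField P) (α β : OneForm E M) (x : M), D.nablaBivector X α β x = 0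

end LeafConnection

/-- `X'` is the push-forward of `X` under the diffeomorphism `φ`:
`X'(φ x) = T_x φ (X x)` for all `x`. If `φ` is a Poisson diffeomorphism, `T φ` preserves `TS`, so
every `X` has exactly one push-forward `X'`. -/
def IsPushforward {P : Bivector E M} (φ : M → M) (X X' : LeafField P) : Prop :=
  ∀ x : M, X' (φ x) = mfderiv 𝓘(ℝ, E) 𝓘(ℝ, E) φ x (X x)

/-- `∇` is invariant under the action of `G`: `g_*(∇_X Y) = ∇_{g_* X} (g_* Y)` for all
`g ∈ G` and `X, Y ∈ Γ^∞(TS)`. -/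
def LeafConnection.IsInvariant {P : Bivector E M} (D : LeafConnection P)
    (G : Type*) [SMul G M] : Prop :=
  ∀ (g : G) (X Y X' Y' : LeafField P), IsPushforward (fun x : M ↦ g • x) X X' →
    IsPushforward (fun x : M ↦ g • x) Y Y' →
      IsPushforward (fun x : M ↦ g • x) (D.nabla X Y) (D.nabla X' Y')

end Defs

end RegularPoisson

end

open Bundle
open scoped Manifold ContDiff

noncomputable section

namespace RegularPoisson

open Filter Topology MeasureTheory Set

/-! ### Differentials of real-valued functions -/

section Differential

variable {E : Type*} [NormedAddCommGroup E] [NormedSpace ℝ E]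
  {M : Type*} [TopologicalSpace M] [ChartedSpace E M]

/-! A connection preserving a symplectic structure on a bundle arises by embedding the bundle
symplectically in a trivial one and projecting the trivial derivative back.

Because the rank of Π♯ is constant, Π♯ has smooth local generalized inverses B, meaning Π♯ B Π♯ = Π♯
(`generalizedInverse_perturb`). Expanding B in a basis, and gluing with a partition of unity, gives
1-forms a_i, b_i with Σ a_i(Y) Π♯b_i = Y for every Y in TS (`exists_dualFrame`). Antisymmetry of Π
then forces Σ b_i(Y) Π♯a_i = -Y. Put ∇_X Y = ½ Σ (X(a_i(Y)) Π♯b_i - X(b_i(Y)) Π♯a_i). The two frame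
identities yield the Leibniz rule (`frameNabla_leibniz`). They also express Π(α, β) through products
of the components of Π♯α and Π♯β, so that ∇Π = 0 is the product rule (`frameNabla_pairing`).

Poisson diffeomorphisms pull dual frames back to dual frames, and the conditions on ∇ are affine.
Averaging the connections of the pulled-back frames over a compact group therefore gives an
invariant Poisson connection (`exists_invariant_poissonConnection`). Mere existence is the case of
the trivial group. -/

lemma differential_add {f h : M → ℝ} {x : M} (hf : MDifferentiableAt 𝓘(ℝ, E) 𝓘(ℝ, ℝ) f x)
    (hh : MDifferentiableAt 𝓘(ℝ, E) 𝓘(ℝ, ℝ) h x) :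
    differential E (fun y ↦ f y + h y) x = differential E f x + differential E h x :=
  (hf.hasMFDerivAt.add hh.hasMFDerivAt).mfderiv

lemma differential_neg (f : M → ℝ) (x : M) :
    differential E (fun y ↦ -f y) x = -differential E f x :=
  mfderiv_neg

lemma differential_sub {f h : M → ℝ} {x : M} (hf : MDifferentiableAt 𝓘(ℝ, E) 𝓘(ℝ, ℝ) f x)
    (hh : MDifferentiableAt 𝓘(ℝ, E) 𝓘(ℝ, ℝ) h x) :
    differential E (fun y ↦ f y - h y) x = differential E f x - differential E h x :=
  (hf.hasMFDerivAt.sub hh.hasMFDerivAt).mfderiv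

lemma differential_mul {f h : M → ℝ} {x : M} (hf : MDifferentiableAt 𝓘(ℝ, E) 𝓘(ℝ, ℝ) f x)
    (hh : MDifferentiableAt 𝓘(ℝ, E) 𝓘(ℝ, ℝ) h x) :
    differential E (fun y ↦ f y * h y) x = f x • differential E h x + h x • differential E f x :=
  (hf.hasMFDerivAt.mul hh.hasMFDerivAt).mfderiv

lemma differential_congr {f h : M → ℝ} {x : M} (hfh : f =ᶠ[𝓝 x] h) :
    differential E f x = differential E h x :=
  hfh.mfderiv_eq

lemma differential_const (c : ℝ) (x : M) : differential E (fun _ : M ↦ c) x = 0 :=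
  mfderiv_const

lemma differential_half_sub {A B A' B' : M → ℝ} {x : M}
    (hA : MDifferentiableAt 𝓘(ℝ, E) 𝓘(ℝ, ℝ) A x) (hB : MDifferentiableAt 𝓘(ℝ, E) 𝓘(ℝ, ℝ) B x)
    (hA' : MDifferentiableAt 𝓘(ℝ, E) 𝓘(ℝ, ℝ) A' x)
    (hB' : MDifferentiableAt 𝓘(ℝ, E) 𝓘(ℝ, ℝ) B' x) (v : TangentSpace 𝓘(ℝ, E) x) :
    MDifferentiableAt 𝓘(ℝ, E) 𝓘(ℝ, ℝ) (fun y ↦ (1 / 2 : ℝ) * (B y * A' y - A y * B' y)) x ∧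
    differential E (fun y ↦ (1 / 2 : ℝ) * (B y * A' y - A y * B' y)) x v =
      1 / 2 * (B x * differential E A' x v + A' x * differential E B x v
        - (A x * differential E B' x v + B' x * differential E A x v)) := by
  have hc : MDifferentiableAt 𝓘(ℝ, E) 𝓘(ℝ, ℝ) (fun _ : M ↦ (1 / 2 : ℝ)) x :=
    mdifferentiableAt_const
  have h1 : MDifferentiableAt 𝓘(ℝ, E) 𝓘(ℝ, ℝ) (fun y ↦ B y * A' y) x := hB.mul hA'
  have h2 : MDifferentiableAt 𝓘(ℝ, E) 𝓘(ℝ, ℝ) (fun y ↦ A y * B' y) x := hA.mul hB'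
  have h3 : MDifferentiableAt 𝓘(ℝ, E) 𝓘(ℝ, ℝ) (fun y ↦ B y * A' y - A y * B' y) x := h1.sub h2
  refine ⟨hc.mul h3, ?_⟩
  rw [differential_mul hc h3, differential_const, differential_sub h1 h2,
    differential_mul hB hA', differential_mul hA hB']
  simp only [_root_.add_apply, _root_.sub_apply, _root_.smul_apply, smul_eq_mul, smul_zero,
    add_zero]

lemma differential_sum {ι : Type*} (J : Finset ι) {f : ι → M → ℝ} {x : M}
    (hf : ∀ i, MDifferentiableAt 𝓘(ℝ, E) 𝓘(ℝ, ℝ) (f i) x) :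
    differential E (fun y ↦ ∑ i ∈ J, f i y) x = ∑ i ∈ J, differential E (f i) x := by
  classical
  have key : MDifferentiableAt 𝓘(ℝ, E) 𝓘(ℝ, ℝ) (fun y ↦ ∑ i ∈ J, f i y) x ∧
      differential E (fun y ↦ ∑ i ∈ J, f i y) x = ∑ i ∈ J, differential E (f i) x := by
    induction J using Finset.induction_on with
    | empty => exact ⟨mdifferentiableAt_const, differential_const 0 x⟩
    | insert i J hi ih =>
      simp only [Finset.sum_insert hi]
      exact ⟨(hf i).add ih.1, by rw [differential_add (hf i) ih.1, ih.2]⟩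
  exact key.2

end Differential

/-! ### The Poisson connection of a dual frame -/

section Frame

variable {E : Type*} [NormedAddCommGroup E] [NormedSpace ℝ E]
  {M : Type*} [TopologicalSpace M] [ChartedSpace E M] [IsManifold 𝓘(ℝ, E) ∞ M]
  {ι : Type*}

/-- Two locally finite families of covector fields `a i`, `b i` such that the two-tensor
`∑ i, a i ⊗ b i` restricts to the leafwise inverse of `Π`. -/
structure IsDualFrame (P : Bivector E M) (a b : ι → ∀ x : M, Cotangent E M x) : Prop where
  contMDiff_left : ∀ i (Y : LeafField P),
    ContMDiff 𝓘(ℝ, E) 𝓘(ℝ, ℝ) ∞ (fun x ↦ a i x (Y x))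
  contMDiff_right : ∀ i (Y : LeafField P),
    ContMDiff 𝓘(ℝ, E) 𝓘(ℝ, ℝ) ∞ (fun x ↦ b i x (Y x))
  locallyFinite : ∀ x, ∃ J : Finset ι, ∀ᶠ y in 𝓝 x, ∀ i ∉ J, a i y = 0 ∧ b i y = 0
  finsum_eq : ∀ x (γ : Cotangent E M x),
    ∑ᶠ i, a i x (P.sharp x γ) • P.sharp x (b i x) = P.sharp x γ

/-- The contribution of a pair `a`, `b` of covector fields to the connection of a dual frame. -/
def derivTerm (P : Bivector E M) (a b : ∀ x : M, Cotangent E M x) (X Y : LeafField P) (x : M) :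
    TangentSpace 𝓘(ℝ, E) x :=
  differential E (fun y ↦ a y (Y y)) x (X x) • P.sharp x (b x)
    - differential E (fun y ↦ b y (Y y)) x (X x) • P.sharp x (a x)

/-- The covariant derivative obtained from the trivial connection by embedding `TS` symplectically
in a trivial bundle by means of a dual frame. -/
def frameNabla (P : Bivector E M) (a b : ι → ∀ x : M, Cotangent E M x) (X Y : LeafField P)
    (x : M) : TangentSpace 𝓘(ℝ, E) x :=
  (1 / 2 : ℝ) • ∑ᶠ i, derivTerm P (a i) (b i) X Y x

lemma derivTerm_mem (P : Bivector E M) (a b : ∀ x : M, Cotangent E M x) (X Y : LeafField P)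
    (x : M) : derivTerm P a b X Y x ∈ P.leafTangent x :=
  Submodule.sub_mem _ (Submodule.smul_mem _ _ ⟨b x, rfl⟩) (Submodule.smul_mem _ _ ⟨a x, rfl⟩)

lemma frameNabla_mem (P : Bivector E M) (a b : ι → ∀ x : M, Cotangent E M x)
    (X Y : LeafField P) (x : M) : frameNabla P a b X Y x ∈ P.leafTangent x :=
  Submodule.smul_mem _ _
    (finsum_induction _ (Submodule.zero_mem _) (fun _ _ ↦ Submodule.add_mem _)
      fun _ ↦ derivTerm_mem P _ _ X Y x)

lemma derivTerm_eq_zero {P : Bivector E M} {a b : ∀ x : M, Cotangent E M x} {x : M}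
    (h : a x = 0 ∧ b x = 0) (X Y : LeafField P) : derivTerm P a b X Y x = 0 := by
  simp [derivTerm, h.1, h.2]

namespace IsDualFrame

variable {P : Bivector E M} {a b : ι → ∀ x : M, Cotangent E M x}

lemma frameNabla_eq_sum {x : M} {J : Finset ι} (hJ : ∀ i ∉ J, a i x = 0 ∧ b i x = 0)
    (X Y : LeafField P) :
    frameNabla P a b X Y x = (1 / 2 : ℝ) • ∑ i ∈ J, derivTerm P (a i) (b i) X Y x := by
  rw [frameNabla, finsum_eq_sum_of_support_subset]
  intro i hi
  by_contra h
  exact hi (derivTerm_eq_zero (hJ i h) X Y)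

lemma sum_eq (h : IsDualFrame P a b) {x : M} {J : Finset ι}
    (hJ : ∀ i ∉ J, a i x = 0 ∧ b i x = 0) (γ : Cotangent E M x) :
    ∑ i ∈ J, a i x (P.sharp x γ) • P.sharp x (b i x) = P.sharp x γ := by
  rw [← finsum_eq_sum_of_support_subset, h.finsum_eq x γ]
  intro i hi
  by_contra h'
  exact hi (by simp [(hJ i h').1])

/-- Apply δ to the frame identity and use antisymmetry of Π. In particular Σ a_i ⊗ b_i is
automatically antisymmetric on TS. -/
lemma sum_pairing (h : IsDualFrame P a b) {x : M} {J : Finset ι}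
    (hJ : ∀ i ∉ J, a i x = 0 ∧ b i x = 0) (γ δ : Cotangent E M x) :
    ∑ i ∈ J, a i x (P.sharp x γ) * b i x (P.sharp x δ) = -δ (P.sharp x γ) := by
  have := congrArg δ (h.sum_eq hJ γ)
  rw [map_sum] at this
  rw [← this, ← Finset.sum_neg_distrib]
  refine Finset.sum_congr rfl fun i _ ↦ ?_
  rw [map_smul, P.antisymm x (b i x) δ]
  simp

/-- The transpose of the frame identity: testing against a covector γ reduces it to `sum_pairing`,
and the sign comes from antisymmetry. -/
lemma sum_swap_eq (h : IsDualFrame P a b) {x : M} {J : Finset ι}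
    (hJ : ∀ i ∉ J, a i x = 0 ∧ b i x = 0) (δ : Cotangent E M x) :
    ∑ i ∈ J, b i x (P.sharp x δ) • P.sharp x (a i x) = -P.sharp x δ := by
  refine (SeparatingDual.eq_iff_forall_dual_eq (R := ℝ) (V := E)).2 fun (γ : Cotangent E M x) ↦ ?_
  have := h.sum_pairing hJ γ δ
  rw [P.antisymm, neg_neg] at this
  change γ _ = γ _
  rw [map_sum, map_neg, ← this, ← Finset.sum_neg_distrib]
  refine Finset.sum_congr rfl fun i _ ↦ ?_
  rw [map_smul, P.antisymm x (a i x) γ]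
  simp [mul_comm]

variable (h : IsDualFrame P a b)
include h

lemma mdifferentiableAt_left (i : ι) (Y : LeafField P) (x : M) :
    MDifferentiableAt 𝓘(ℝ, E) 𝓘(ℝ, ℝ) (fun x ↦ a i x (Y x)) x :=
  (h.contMDiff_left i Y x).mdifferentiableAt (by simp)

lemma mdifferentiableAt_right (i : ι) (Y : LeafField P) (x : M) :
    MDifferentiableAt 𝓘(ℝ, E) 𝓘(ℝ, ℝ) (fun x ↦ b i x (Y x)) x :=
  (h.contMDiff_right i Y x).mdifferentiableAt (by simp)

lemma exists_finset (x : M) : ∃ J : Finset ι, ∀ i ∉ J, a i x = 0 ∧ b i x = 0 :=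
  let ⟨J, hJ⟩ := h.locallyFinite x
  ⟨J, hJ.self_of_nhds⟩

lemma frameNabla_add_left (X X' Y : LeafField P) (x : M) :
    frameNabla P a b (X + X') Y x = frameNabla P a b X Y x + frameNabla P a b X' Y x := by
  obtain ⟨J, hJ⟩ := h.exists_finset x
  simp only [frameNabla_eq_sum hJ]
  rw [← smul_add, ← Finset.sum_add_distrib]
  congr 1
  refine Finset.sum_congr rfl fun i _ ↦ ?_
  have : (X + X') x = X x + X' x := rfl
  simp only [derivTerm, this, map_add]
  module

lemma frameNabla_smul_left (f : C^∞⟮𝓘(ℝ, E), M; ℝ⟯) (X Y : LeafField P) (x : M) :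
    frameNabla P a b (f • X) Y x = f x • frameNabla P a b X Y x := by
  obtain ⟨J, hJ⟩ := h.exists_finset x
  simp only [frameNabla_eq_sum hJ]
  rw [smul_comm, Finset.smul_sum (r := f x)]
  congr 1
  refine Finset.sum_congr rfl fun i _ ↦ ?_
  have : (f • X) x = f x • X x := rfl
  simp only [derivTerm, this, map_smul, smul_eq_mul]
  module

lemma frameNabla_add_right (X Y Y' : LeafField P) (x : M) :
    frameNabla P a b X (Y + Y') x = frameNabla P a b X Y x + frameNabla P a b X Y' x := by
  obtain ⟨J, hJ⟩ := h.exists_finset x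
  simp only [frameNabla_eq_sum hJ]
  rw [← smul_add, ← Finset.sum_add_distrib]
  congr 1
  refine Finset.sum_congr rfl fun i _ ↦ ?_
  have hY : ∀ y, (Y + Y') y = Y y + Y' y := fun _ ↦ rfl
  simp only [derivTerm, hY, map_add]
  rw [differential_add (h.mdifferentiableAt_left i Y x) (h.mdifferentiableAt_left i Y' x),
    differential_add (h.mdifferentiableAt_right i Y x) (h.mdifferentiableAt_right i Y' x)]
  simp only [_root_.add_apply]
  module

lemma frameNabla_leibniz (f : C^∞⟮𝓘(ℝ, E), M; ℝ⟯) (X Y : LeafField P) (x : M) :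
    frameNabla P a b X (f • Y) x =
      f x • frameNabla P a b X Y x + differential E f x (X x) • Y x := by
  obtain ⟨J, hJ⟩ := h.exists_finset x
  obtain ⟨γ, hγ⟩ : ∃ γ : Cotangent E M x, P.sharp x γ = Y x := Y.mem x
  have hf : MDifferentiableAt 𝓘(ℝ, E) 𝓘(ℝ, ℝ) f x := (f.contMDiff x).mdifferentiableAt (by simp)
  have h1 := h.sum_eq hJ γ
  have h2 := h.sum_swap_eq hJ γ
  rw [hγ] at h1 h2
  have hY : ∀ y, (f • Y) y = f y • Y y := fun _ ↦ rfl
  have hterm : ∀ i, derivTerm P (a i) (b i) X (f • Y) x =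
      f x • derivTerm P (a i) (b i) X Y x + differential E f x (X x) •
        (a i x (Y x) • P.sharp x (b i x) - b i x (Y x) • P.sharp x (a i x)) := fun i ↦ by
    simp only [derivTerm, hY, map_smul, smul_eq_mul]
    rw [differential_mul hf (h.mdifferentiableAt_left i Y x),
      differential_mul hf (h.mdifferentiableAt_right i Y x)]
    simp only [_root_.add_apply, _root_.smul_apply, smul_eq_mul]
    module
  simp only [frameNabla_eq_sum hJ, hterm]
  -- The terms containing the derivative of f add up to Y - (-Y) = 2Y, which the factor 1/2
  -- compensates.
  rw [Finset.sum_add_distrib, ← Finset.smul_sum, ← Finset.smul_sum, Finset.sum_sub_distrib, h1, h2]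
  module

/-- The connection of a dual frame is compatible with `Π`. -/
lemma frameNabla_pairing (X : LeafField P) (α β : OneForm E M) (x : M) :
    β x (frameNabla P a b X (P.sharpForm α) x) - α x (frameNabla P a b X (P.sharpForm β) x) =
      differential E (fun y ↦ P.pairing y (α y) (β y)) x (X x) := by
  obtain ⟨J, hJ⟩ := h.locallyFinite x
  have hA (i) := h.mdifferentiableAt_left i (P.sharpForm α) x
  have hB (i) := h.mdifferentiableAt_right i (P.sharpForm α) x
  have hA' (i) := h.mdifferentiableAt_left i (P.sharpForm β) x
  have hB' (i) := h.mdifferentiableAt_right i (P.sharpForm β) x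
  -- Half the difference of `sum_pairing` for (β, α) and for (α, β): differentiating this form
  -- produces the four kinds of terms of the connection. One index set must serve a whole
  -- neighbourhood, since the identity is differentiated.
  have hev : (fun y ↦ P.pairing y (α y) (β y)) =ᶠ[𝓝 x] fun y ↦ ∑ i ∈ J, (1 / 2 : ℝ) *
      (b i y (P.sharpForm α y) * a i y (P.sharpForm β y)
        - a i y (P.sharpForm α y) * b i y (P.sharpForm β y)) := by
    filter_upwards [hJ] with y hy
    have h1 := h.sum_pairing hy (α y) (β y)
    have h2 := h.sum_pairing hy (β y) (α y)
    rw [P.antisymm y (β y) (α y)] at h2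
    simp_rw [mul_comm (a _ _ (P.sharp y (β y)))] at h2
    rw [← Finset.mul_sum, Finset.sum_sub_distrib]
    simp only [Bivector.sharpForm, Bivector.pairing]
    linarith
  have hd (i) := differential_half_sub (hA i) (hB i) (hA' i) (hB' i) (X x)
  rw [differential_congr hev, differential_sum J fun i ↦ (hd i).1, _root_.sum_apply]
  simp only [frameNabla_eq_sum hJ.self_of_nhds, map_smul, map_sum]
  rw [Finset.smul_sum, Finset.smul_sum, ← Finset.sum_sub_distrib]
  refine Finset.sum_congr rfl fun i _ ↦ ?_
  rw [(hd i).2]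
  simp only [derivTerm, map_sub, map_smul, smul_eq_mul]
  rw [P.antisymm x (b i x) (α x), P.antisymm x (a i x) (α x), P.antisymm x (b i x) (β x),
    P.antisymm x (a i x) (β x)]
  have e1 : P.sharpForm α x = P.sharp x (α x) := rfl
  have e2 : P.sharpForm β x = P.sharp x (β x) := rfl
  rw [e1, e2]
  ring

end IsDualFrame

end Frame

/-! ### Smoothness of integrals over a compact parameter manifold -/

section ParametricIntegral

universe uE

variable {F : Type*} [NormedAddCommGroup F] [NormedSpace ℝ F]
  {G : Type*} [TopologicalSpace G] [CompactSpace G] [ChartedSpace F G]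
  [IsManifold 𝓘(ℝ, F) ∞ G]
  [MeasurableSpace G] [BorelSpace G] {μ : Measure G} [IsFiniteMeasure μ]
  {E : Type*} [NormedAddCommGroup E] [NormedSpace ℝ E]

omit [CompactSpace G] [MeasurableSpace G] [BorelSpace G] in
lemma contMDiffOn_fderiv_param {V : Type*} [NormedAddCommGroup V] [NormedSpace ℝ V]
    {Φ : G → E → V} {U : Set E} (hU : IsOpen U)
    (hΦ : ContMDiffOn (𝓘(ℝ, F).prod 𝓘(ℝ, E)) 𝓘(ℝ, V) ∞ (Function.uncurry Φ) (univ ×ˢ U)) :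
    ContMDiffOn (𝓘(ℝ, F).prod 𝓘(ℝ, E)) 𝓘(ℝ, E →L[ℝ] V) ∞
      (Function.uncurry fun g u ↦ fderiv ℝ (Φ g) u) (univ ×ˢ U) := by
  rintro ⟨g, u⟩ hu
  have h := hΦ.contMDiffAt ((isOpen_univ.prod hU).mem_nhds hu)
  have h' : ContMDiffAt ((𝓘(ℝ, F).prod 𝓘(ℝ, E)).prod 𝓘(ℝ, E)) 𝓘(ℝ, V) ∞
      (Function.uncurry fun (p : G × E) (v : E) ↦ Φ p.1 v) ((g, u), u) :=
    ContMDiffAt.comp ((g, u), u) (g := Function.uncurry Φ) (f := fun q : (G × E) × E ↦ (q.1.1, q.2))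
      h ((contMDiffAt_fst.comp _ contMDiffAt_fst).prodMk contMDiffAt_snd)
  have key := ContMDiffAt.mfderiv (m := ∞) (n := ∞) (fun (p : G × E) (v : E) ↦ Φ p.1 v)
    (fun p : G × E ↦ p.2) h' contMDiffAt_snd (by simp)
  erw [inTangentCoordinates_model_space] at key
  simp only [mfderiv_eq_fderiv] at key
  exact key.contMDiffWithinAt

variable [FiniteDimensional ℝ E]

lemma hasFDerivAt_integral_param {V : Type*} [NormedAddCommGroup V] [NormedSpace ℝ V]
    [FiniteDimensional ℝ V] {Φ : G → E → V} {U : Set E} (hU : IsOpen U)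
    (hΦ : ContMDiffOn (𝓘(ℝ, F).prod 𝓘(ℝ, E)) 𝓘(ℝ, V) ∞ (Function.uncurry Φ) (univ ×ˢ U))
    {u : E} (hu : u ∈ U) :
    HasFDerivAt (fun v ↦ ∫ g, Φ g v ∂μ) (∫ g, fderiv ℝ (Φ g) u ∂μ) u := by
  have := FiniteDimensional.proper_real E
  have := FiniteDimensional.proper_real V
  have := FiniteDimensional.proper_real (E →L[ℝ] V)
  obtain ⟨r, hr, hrU⟩ := Metric.nhds_basis_closedBall.mem_iff.1 (hU.mem_nhds hu)
  have hcont : ∀ v ∈ U, Continuous fun g ↦ Φ g v := fun v hv ↦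
    hΦ.continuousOn.comp_continuous (f := fun g : G ↦ (g, v)) (by fun_prop) fun g ↦ ⟨trivial, hv⟩
  have hΦ' := contMDiffOn_fderiv_param hU hΦ
  have hcont' : Continuous fun g ↦ fderiv ℝ (Φ g) u :=
    hΦ'.continuousOn.comp_continuous (f := fun g : G ↦ (g, u)) (by fun_prop) fun g ↦ ⟨trivial, hu⟩
  -- Compactness of G times a closed ball gives a constant dominating function, integrable because μ
  -- is finite.
  obtain ⟨C, hC⟩ := (isCompact_univ.prod (isCompact_closedBall u r)).exists_bound_of_continuousOn
    (hΦ'.continuousOn.mono (prod_mono_right hrU))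
  refine hasFDerivAt_integral_of_dominated_of_fderiv_le (F' := fun v g ↦ fderiv ℝ (Φ g) v)
    (bound := fun _ ↦ C) (Metric.closedBall_mem_nhds u hr) ?_ ?_ hcont'.aestronglyMeasurable ?_
    (integrable_const C) ?_
  · filter_upwards [hU.mem_nhds hu] with v hv using (hcont v hv).aestronglyMeasurable
  · exact (hcont u hu).integrable_of_hasCompactSupport (.of_compactSpace _)
  · exact .of_forall fun g v hv ↦ hC (g, v) ⟨trivial, hv⟩
  · refine .of_forall fun g v hv ↦ DifferentiableAt.hasFDerivAt ?_
    have h := hΦ.contMDiffAt ((isOpen_univ.prod hU).mem_nhds (x := (g, v)) ⟨trivial, hrU hv⟩)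
    have h' : ContMDiffAt 𝓘(ℝ, E) 𝓘(ℝ, V) ∞ (Φ g) v :=
      ContMDiffAt.comp v (g := Function.uncurry Φ) (f := fun v ↦ (g, v)) h
        (contMDiffAt_const.prodMk contMDiffAt_id)
    exact h'.contDiffAt.differentiableAt (by simp)

/-- The derivative is again a parametric integral, now with values in `E →L[ℝ] V`, so the induction
runs over all V. Placing E and V in one universe keeps `E →L[ℝ] V` within its range. -/
lemma contDiffOn_integral_param_nat {E : Type uE} [NormedAddCommGroup E] [NormedSpace ℝ E]
    [FiniteDimensional ℝ E] (n : ℕ) : ∀ {V : Type uE} [NormedAddCommGroup V] [NormedSpace ℝ V]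
    [FiniteDimensional ℝ V] {Φ : G → E → V} {U : Set E}, IsOpen U →
    ContMDiffOn (𝓘(ℝ, F).prod 𝓘(ℝ, E)) 𝓘(ℝ, V) ∞ (Function.uncurry Φ) (univ ×ˢ U) →
    ContDiffOn ℝ n (fun v ↦ ∫ g, Φ g v ∂μ) U := by
  induction n with
  | zero =>
    intro V _ _ _ Φ U hU hΦ
    exact contDiffOn_zero.2 fun u hu ↦
      (hasFDerivAt_integral_param hU hΦ hu).continuousAt.continuousWithinAt
  | succ n ih =>
    intro V _ _ _ Φ U hU hΦ
    rw [Nat.cast_succ, contDiffOn_succ_iff_fderiv_of_isOpen hU]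
    refine ⟨fun u hu ↦ (hasFDerivAt_integral_param hU hΦ hu).differentiableAt.differentiableWithinAt,
      by simp, ?_⟩
    exact (ih hU (contMDiffOn_fderiv_param hU hΦ)).congr fun u hu ↦
      (hasFDerivAt_integral_param hU hΦ hu).fderiv

lemma contMDiff_integral_section {E : Type uE} [NormedAddCommGroup E] [NormedSpace ℝ E]
    [FiniteDimensional ℝ E]
    {M : Type*} [TopologicalSpace M] [ChartedSpace E M] [IsManifold 𝓘(ℝ, E) ∞ M]
    (s : G → ∀ x : M, TangentSpace 𝓘(ℝ, E) x)
    (hs : ContMDiff (𝓘(ℝ, F).prod 𝓘(ℝ, E)) 𝓘(ℝ, E).tangent ∞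
      (fun p : G × M ↦ (⟨p.2, s p.1 p.2⟩ : TangentBundle 𝓘(ℝ, E) M))) :
    ContMDiff 𝓘(ℝ, E) 𝓘(ℝ, E).tangent ∞
      (fun x ↦ (⟨x, (∫ g, (s g x : E) ∂μ : E)⟩ : TangentBundle 𝓘(ℝ, E) M)) := by
  intro x₀
  let e := trivializationAt E (TangentSpace 𝓘(ℝ, E) (M := M)) x₀
  have hbase : e.baseSet = (chartAt E x₀).source := TangentBundle.trivializationAt_baseSet x₀
  have hx₀ : x₀ ∈ e.baseSet := mem_baseSet_trivializationAt E (TangentSpace 𝓘(ℝ, E) (M := M)) x₀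
  let ψ : G → M → E := fun g x ↦ (e ⟨x, s g x⟩).2
  have hψ : ContMDiffOn (𝓘(ℝ, F).prod 𝓘(ℝ, E)) 𝓘(ℝ, E) ∞ (Function.uncurry ψ)
      (univ ×ˢ e.baseSet) :=
    ((e.contMDiffOn_iff (IB := 𝓘(ℝ, E)) fun p hp ↦ e.mem_source.2 hp.2).1 hs.contMDiffOn).2
  -- A trivialization is linear on each fibre, so it commutes with the fibrewise integral.
  have hint : ∀ x ∈ e.baseSet, (e ⟨x, (∫ g, (s g x : E) ∂μ : E)⟩).2 = ∫ g, ψ g x ∂μ := by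
    intro x hx
    let L : E ≃L[ℝ] E := e.continuousLinearEquivAt ℝ x hx
    exact (L.integral_comp_comm fun g ↦ (s g x : E)).symm
  refine (contMDiffAt_section (F := E) (E := TangentSpace 𝓘(ℝ, E) (M := M)) x₀).2 ?_
  refine ContMDiffAt.congr_of_eventuallyEq (f := fun x ↦ ∫ g, ψ g x ∂μ) ?_
    (by filter_upwards [e.open_baseSet.mem_nhds hx₀] with x hx using hint x hx)
  have htarget : IsOpen (extChartAt 𝓘(ℝ, E) x₀).target := isOpen_extChartAt_target x₀
  have hΦ : ContMDiffOn (𝓘(ℝ, F).prod 𝓘(ℝ, E)) 𝓘(ℝ, E) ∞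
      (Function.uncurry fun g u ↦ ψ g ((extChartAt 𝓘(ℝ, E) x₀).symm u))
      (univ ×ˢ (extChartAt 𝓘(ℝ, E) x₀).target) := by
    refine hψ.comp (f := fun p : G × E ↦ (p.1, (extChartAt 𝓘(ℝ, E) x₀).symm p.2))
      (contMDiffOn_fst.prodMk
        ((contMDiffOn_extChartAt_symm x₀).comp contMDiffOn_snd fun p hp ↦ hp.2)) ?_
    rintro ⟨g, u⟩ ⟨-, hu⟩
    refine ⟨trivial, ?_⟩
    rw [hbase]
    simpa using (extChartAt 𝓘(ℝ, E) x₀).map_target hu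
  rw [contMDiffAt_iff_source]
  refine ContMDiffAt.contMDiffWithinAt (ContDiffAt.contMDiffAt ?_)
  exact (contDiffOn_infty.2 fun n ↦ contDiffOn_integral_param_nat n htarget hΦ).contDiffAt
    (htarget.mem_nhds (mem_extChartAt_target x₀))

end ParametricIntegral

/-! ### Pointwise form of the Poisson condition on maps -/

section PoissonMap

variable {E : Type*} [NormedAddCommGroup E] [NormedSpace ℝ E] [FiniteDimensional ℝ E]
  {M : Type*} [TopologicalSpace M] [T2Space M] [ChartedSpace E M] [IsManifold 𝓘(ℝ, E) ∞ M]

/-- Every covector is the differential of a smooth function. -/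
lemma exists_differential_eq (x : M) (γ : Cotangent E M x) :
    ∃ f : M → ℝ, ContMDiff 𝓘(ℝ, E) 𝓘(ℝ, ℝ) ∞ f ∧ differential E f x = γ := by
  let χ : SmoothBumpFunction 𝓘(ℝ, E) x := Classical.arbitrary _
  have hinv := isInvertible_mfderiv_extChartAt (I := 𝓘(ℝ, E))
    (mem_extChartAt_source (I := 𝓘(ℝ, E)) x)
  obtain ⟨L, hL⟩ := hinv
  let δ : E →L[ℝ] ℝ := (γ.comp L.symm.toContinuousLinearMap :
    TangentSpace 𝓘(ℝ, E) (extChartAt 𝓘(ℝ, E) x x) →L[ℝ] ℝ)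
  refine ⟨fun y ↦ χ y • δ (extChartAt 𝓘(ℝ, E) x y), χ.contMDiff_smul ?_, ?_⟩
  · exact δ.contMDiff.comp_contMDiffOn contMDiffOn_extChartAt
  · have h1 : (fun y ↦ χ y • δ (extChartAt 𝓘(ℝ, E) x y)) =ᶠ[𝓝 x]
        fun y ↦ δ (extChartAt 𝓘(ℝ, E) x y) := by
      filter_upwards [χ.eventuallyEq_one] with y hy
      simp [hy]
    rw [differential_congr h1]
    have h2 : HasMFDerivAt 𝓘(ℝ, E) 𝓘(ℝ, ℝ) (δ ∘ extChartAt 𝓘(ℝ, E) x) x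
        (δ.comp L.toContinuousLinearMap) := by
      refine HasMFDerivAt.comp x (δ.hasMFDerivAt) ?_
      rw [hL]
      exact (mdifferentiableAt_extChartAt (mem_chart_source E x)).hasMFDerivAt
    refine h2.mfderiv.trans ?_
    ext v
    change γ (L.symm (L v)) = γ v
    rw [L.symm_apply_apply]

/-- Poisson maps intertwine the maps `Π♯`. -/
lemma Bivector.IsPoissonMap.mfderiv_sharp {P : Bivector E M} {φ : M → M} (h : P.IsPoissonMap φ)
    (x : M) (γ : Cotangent E M (φ x)) :
    mfderiv 𝓘(ℝ, E) 𝓘(ℝ, E) φ x (P.sharp x (γ.comp (mfderiv 𝓘(ℝ, E) 𝓘(ℝ, E) φ x))) =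
      P.sharp (φ x) γ := by
  refine (SeparatingDual.eq_iff_forall_dual_eq (R := ℝ) (V := E)).2
    fun (δ : Cotangent E M (φ x)) ↦ ?_
  -- Both covectors are differentials of global smooth functions, so preservation of brackets tests
  -- the identity completely.
  obtain ⟨f, hf, rfl⟩ := exists_differential_eq (φ x) γ
  obtain ⟨k, hk, rfl⟩ := exists_differential_eq (φ x) δ
  have key := congrFun (h.2 f k hf hk) x
  have hφ := (h.1 x).mdifferentiableAt (by simp)
  have hc : ∀ u : M → ℝ, ContMDiff 𝓘(ℝ, E) 𝓘(ℝ, ℝ) ∞ u → differential E (u ∘ φ) x =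
      (differential E u (φ x)).comp (mfderiv 𝓘(ℝ, E) 𝓘(ℝ, E) φ x) := fun u hu ↦
    mfderiv_comp x ((hu _).mdifferentiableAt (by simp)) hφ
  simp only [Bivector.bracket, Bivector.pairing, hc f hf, hc k hk, Function.comp] at key
  exact key

end PoissonMap

/-! ### Smooth dependence on parameters -/

section Param

variable {EN : Type*} [NormedAddCommGroup EN] [NormedSpace ℝ EN]
  {HN : Type*} [TopologicalSpace HN] {J : ModelWithCorners ℝ EN HN}
  {N : Type*} [TopologicalSpace N] [ChartedSpace HN N]
  {F : Type*} [NormedAddCommGroup F] [NormedSpace ℝ F]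
  {G : Type*} [TopologicalSpace G] [ChartedSpace F G] [IsManifold 𝓘(ℝ, F) ∞ G]
  {E : Type*} [NormedAddCommGroup E] [NormedSpace ℝ E]
  {M : Type*} [TopologicalSpace M] [ChartedSpace E M] [IsManifold 𝓘(ℝ, E) ∞ M]
  {E' : Type*} [NormedAddCommGroup E'] [NormedSpace ℝ E']
  {M' : Type*} [TopologicalSpace M'] [ChartedSpace E' M'] [IsManifold 𝓘(ℝ, E') ∞ M']

/-- The partial derivative along M is the full tangent map of m evaluated on (0, v), and the tangent
map is smooth. -/
lemma contMDiff_mfderiv_param {m : G × M → M'}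
    (hm : ContMDiff (𝓘(ℝ, F).prod 𝓘(ℝ, E)) 𝓘(ℝ, E') ∞ m)
    {σ : N → G} (hσ : ContMDiff J 𝓘(ℝ, F) ∞ σ) {τ : N → M} {v : ∀ n, TangentSpace 𝓘(ℝ, E) (τ n)}
    (hv : ContMDiff J 𝓘(ℝ, E).tangent ∞ (fun n ↦ (⟨τ n, v n⟩ : TangentBundle 𝓘(ℝ, E) M))) :
    ContMDiff J 𝓘(ℝ, E').tangent ∞ (fun n ↦ (⟨m (σ n, τ n),
      mfderiv 𝓘(ℝ, E) 𝓘(ℝ, E') (fun y ↦ m (σ n, y)) (τ n) (v n)⟩ : TangentBundle 𝓘(ℝ, E') M')) := by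
  have h0 : ContMDiff J 𝓘(ℝ, F).tangent ∞
      (fun n ↦ (⟨σ n, 0⟩ : TangentBundle 𝓘(ℝ, F) G)) :=
    (contMDiff_zeroSection ℝ (TangentSpace 𝓘(ℝ, F) (M := G))).comp hσ
  have h1 := (contMDiff_equivTangentBundleProd_symm (n := ∞) (I := 𝓘(ℝ, F)) (M := G)
    (I' := 𝓘(ℝ, E)) (M' := M)).comp (h0.prodMk hv)
  refine ((hm.contMDiff_tangentMap (m := ∞) (by simp)).comp h1).congr fun n ↦ ?_
  have hmd : MDifferentiableAt (𝓘(ℝ, F).prod 𝓘(ℝ, E)) 𝓘(ℝ, E') m (σ n, τ n) :=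
    (hm _).mdifferentiableAt (by simp)
  let z : E := v n
  have := mfderiv_prod_eq_add_apply (v := ((0 : F), z)) hmd
  refine congrArg (fun w ↦ (⟨m (σ n, τ n), w⟩ : TangentBundle 𝓘(ℝ, E') M'))
    (Eq.symm (this.trans ?_))
  exact (congrArg (· + _) (map_zero _)).trans (zero_add _)

lemma contMDiff_differential_param {u : G × M → ℝ}
    (hu : ContMDiff (𝓘(ℝ, F).prod 𝓘(ℝ, E)) 𝓘(ℝ, ℝ) ∞ u)
    {σ : N → G} (hσ : ContMDiff J 𝓘(ℝ, F) ∞ σ) {τ : N → M} {v : ∀ n, TangentSpace 𝓘(ℝ, E) (τ n)}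
    (hv : ContMDiff J 𝓘(ℝ, E).tangent ∞ (fun n ↦ (⟨τ n, v n⟩ : TangentBundle 𝓘(ℝ, E) M))) :
    ContMDiff J 𝓘(ℝ, ℝ) ∞ (fun n ↦ differential E (fun y ↦ u (σ n, y)) (τ n) (v n)) :=
  (contMDiff_snd_tangentBundle_modelSpace ℝ 𝓘(ℝ, ℝ)).comp (contMDiff_mfderiv_param hu hσ hv)

lemma contMDiffAt_sum_smul {κ : Type*} {K : Finset κ} {τ : N → M} {n₀ : N} {c : κ → N → ℝ}
    {w : κ → ∀ n, TangentSpace 𝓘(ℝ, E) (τ n)} (hτ : ContMDiffAt J 𝓘(ℝ, E) ∞ τ n₀)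
    (hc : ∀ k ∈ K, ContMDiffAt J 𝓘(ℝ, ℝ) ∞ (c k) n₀)
    (hw : ∀ k ∈ K, ContMDiffAt J 𝓘(ℝ, E).tangent ∞
      (fun n ↦ (⟨τ n, w k n⟩ : TangentBundle 𝓘(ℝ, E) M)) n₀) :
    ContMDiffAt J 𝓘(ℝ, E).tangent ∞
      (fun n ↦ (⟨τ n, ∑ k ∈ K, c k n • w k n⟩ : TangentBundle 𝓘(ℝ, E) M)) n₀ := by
  let e := trivializationAt E (TangentSpace 𝓘(ℝ, E) (M := M)) (τ n₀)
  have hx₀ : τ n₀ ∈ e.baseSet :=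
    mem_baseSet_trivializationAt E (TangentSpace 𝓘(ℝ, E) (M := M)) (τ n₀)
  refine contMDiffAt_totalSpace.2 ⟨hτ, ?_⟩
  have h : ContMDiffAt J 𝓘(ℝ, E) ∞ (fun n ↦ ∑ k ∈ K, c k n • (e ⟨τ n, w k n⟩).2) n₀ :=
    ContMDiffAt.sum fun k hk ↦ (hc k hk).smul (contMDiffAt_totalSpace.1 (hw k hk)).2
  refine h.congr_of_eventuallyEq ?_
  filter_upwards [hτ.continuousAt.preimage_mem_nhds (e.open_baseSet.mem_nhds hx₀)] with n hn
  have hlin : ∀ z : TangentSpace 𝓘(ℝ, E) (τ n), (e ⟨τ n, z⟩).2 = e.continuousLinearEquivAt ℝ _ hn z :=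
    fun _ ↦ rfl
  change (e ⟨τ n, _⟩).2 = _
  simp only [hlin, map_sum, map_smul]

end Param

/-! ### Naturality of the frame connection -/

section Pullback

variable {E : Type*} [NormedAddCommGroup E] [NormedSpace ℝ E]
  {M : Type*} [TopologicalSpace M] [ChartedSpace E M] [IsManifold 𝓘(ℝ, E) ∞ M]
  {ι : Type*} {P : Bivector E M}

/-- The pull-back of a covector field along a map. -/
def pullCovector (φ : M → M) (a : ∀ x : M, Cotangent E M x) (x : M) : Cotangent E M x :=
  (a (φ x)).comp (mfderiv 𝓘(ℝ, E) 𝓘(ℝ, E) φ x)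

omit [IsManifold 𝓘(ℝ, E) ∞ M] in
lemma pullCovector_eq_zero {φ : M → M} {a : ∀ x : M, Cotangent E M x} {x : M} (h : a (φ x) = 0) :
    pullCovector φ a x = 0 := by
  rw [pullCovector, h]
  exact ContinuousLinearMap.zero_comp _

omit [IsManifold 𝓘(ℝ, E) ∞ M] in
lemma pullCovector_comp {φ ψ : M → M} (hφ : ContMDiff 𝓘(ℝ, E) 𝓘(ℝ, E) ∞ φ)
    (hψ : ContMDiff 𝓘(ℝ, E) 𝓘(ℝ, E) ∞ ψ) (a : ∀ x : M, Cotangent E M x) :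
    pullCovector ψ (pullCovector φ a) = pullCovector (φ ∘ ψ) a := by
  funext x
  rw [pullCovector, pullCovector, pullCovector, mfderiv_comp x
    ((hφ _).mdifferentiableAt (by simp)) ((hψ _).mdifferentiableAt (by simp))]
  rfl

lemma differential_pullCovector_apply {ψ : M → M} (hψ : ContMDiff 𝓘(ℝ, E) 𝓘(ℝ, E) ∞ ψ)
    {X Y X' Y' : LeafField P} (hX : IsPushforward ψ X X') (hY : IsPushforward ψ Y Y')
    {a : ∀ x : M, Cotangent E M x}
    (ha : ContMDiff 𝓘(ℝ, E) 𝓘(ℝ, ℝ) ∞ fun y ↦ a y (Y' y)) (x : M) :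
    differential E (fun y ↦ a y (Y' y)) (ψ x) (X' (ψ x)) =
      differential E (fun y ↦ pullCovector ψ a y (Y y)) x (X x) := by
  have h1 : (fun y ↦ pullCovector ψ a y (Y y)) = (fun y ↦ a y (Y' y)) ∘ ψ := by
    funext y
    exact congrArg (a (ψ y)) (hY y).symm
  have h2 : differential E ((fun y ↦ a y (Y' y)) ∘ ψ) x =
      (differential E (fun y ↦ a y (Y' y)) (ψ x)).comp (mfderiv 𝓘(ℝ, E) 𝓘(ℝ, E) ψ x) :=
    mfderiv_comp x ((ha _).mdifferentiableAt (by simp)) ((hψ _).mdifferentiableAt (by simp))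
  rw [h1, h2, hX x]
  rfl

lemma frameNabla_pushforward {ψ : M → M} (hψ : ContMDiff 𝓘(ℝ, E) 𝓘(ℝ, E) ∞ ψ)
    (hinj : ∀ x, Function.Injective (mfderiv 𝓘(ℝ, E) 𝓘(ℝ, E) ψ x))
    (hP : ∀ (x : M) (γ : Cotangent E M (ψ x)), mfderiv 𝓘(ℝ, E) 𝓘(ℝ, E) ψ x
      (P.sharp x (γ.comp (mfderiv 𝓘(ℝ, E) 𝓘(ℝ, E) ψ x))) = P.sharp (ψ x) γ)
    {a b : ι → ∀ x : M, Cotangent E M x} (hab : IsDualFrame P a b)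
    {X Y X' Y' : LeafField P} (hX : IsPushforward ψ X X') (hY : IsPushforward ψ Y Y') (x : M) :
    frameNabla P a b X' Y' (ψ x) = mfderiv 𝓘(ℝ, E) 𝓘(ℝ, E) ψ x
      (frameNabla P (fun i ↦ pullCovector ψ (a i)) (fun i ↦ pullCovector ψ (b i)) X Y x) := by
  let L : TangentSpace 𝓘(ℝ, E) x →L[ℝ] TangentSpace 𝓘(ℝ, E) (ψ x) :=
    mfderiv 𝓘(ℝ, E) 𝓘(ℝ, E) ψ x
  change _ = L _
  -- Injectivity lets the derivative pass through the `finsum` without any finiteness argument.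
  have := AddMonoidHom.map_finsum_of_injective L.toLinearMap.toAddMonoidHom (hinj x) fun i ↦
    derivTerm P (pullCovector ψ (a i)) (pullCovector ψ (b i)) X Y x
  rw [frameNabla, frameNabla, map_smul]
  refine congrArg _ (Eq.trans (finsum_congr fun i ↦ ?_) this.symm)
  change _ = L _
  rw [derivTerm, derivTerm, map_sub, map_smul, map_smul,
    differential_pullCovector_apply hψ hX hY (hab.contMDiff_left i Y'),
    differential_pullCovector_apply hψ hX hY (hab.contMDiff_right i Y')]
  congr 2
  · exact (hP x (b i (ψ x))).symm
  · exact (hP x (a i (ψ x))).symm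

end Pullback

/-! ### Dual frames pulled back by a Poisson action -/

section Action

variable {F : Type*} [NormedAddCommGroup F] [NormedSpace ℝ F]
  {G : Type*} [TopologicalSpace G] [ChartedSpace F G] [Group G] [LieGroup 𝓘(ℝ, F) ∞ G]
  {E : Type*} [NormedAddCommGroup E] [NormedSpace ℝ E] [FiniteDimensional ℝ E]
  {M : Type*} [TopologicalSpace M] [T2Space M] [ChartedSpace E M] [IsManifold 𝓘(ℝ, E) ∞ M]
  [MulAction G M] [ContMDiffSMul 𝓘(ℝ, F) 𝓘(ℝ, E) ∞ G M]
  {ι : Type*} {P : Bivector E M}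

variable (F) in
/-- The derivative of the action of a group element, as a linear equivalence. -/
def smulDeriv (g : G) (x : M) : TangentSpace 𝓘(ℝ, E) x ≃L[ℝ] TangentSpace 𝓘(ℝ, E) (g • x) :=
  (Diffeomorph.smul 𝓘(ℝ, F) 𝓘(ℝ, E) ∞ g : M ≃ₘ^∞⟮𝓘(ℝ, E), 𝓘(ℝ, E)⟯ M).mfderivToContinuousLinearEquiv
    (by simp) x

omit [FiniteDimensional ℝ E] [T2Space M] in
lemma contMDiff_pullCovector_smul_apply (a : OneForm E M) (Y : LeafField P) :
    ContMDiff (𝓘(ℝ, F).prod 𝓘(ℝ, E)) 𝓘(ℝ, ℝ) ∞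
      (fun p : G × M ↦ pullCovector (fun y ↦ p.1 • y) a p.2 (Y p.2)) := by
  have h1 : ContMDiff (𝓘(ℝ, F).prod 𝓘(ℝ, E)) 𝓘(ℝ, E).tangent ∞ (fun p : G × M ↦
      (⟨p.1 • p.2, mfderiv 𝓘(ℝ, E) 𝓘(ℝ, E) (fun y : M ↦ p.1 • y) p.2 (Y p.2)⟩ :
        TangentBundle 𝓘(ℝ, E) M)) :=
    contMDiff_mfderiv_param (m := fun p : G × M ↦ p.1 • p.2)
      (contMDiff_smul (I := 𝓘(ℝ, F)) (I' := 𝓘(ℝ, E)) (n := ∞)) contMDiff_fst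
      (Y.contMDiff.comp contMDiff_snd)
  have h2 := ContMDiff.clm_bundle_apply (F₁ := E) (F₂ := ℝ)
    (E₁ := fun x : M ↦ TangentSpace 𝓘(ℝ, E) x) (E₂ := fun _ : M ↦ ℝ)
    (b := fun p : G × M ↦ p.1 • p.2)
    (a.contMDiff.comp (contMDiff_smul (I := 𝓘(ℝ, F)) (I' := 𝓘(ℝ, E)) (n := ∞))) h1
  intro p
  exact (contMDiffAt_totalSpace.1 (h2 p)).2

variable (hP : ∀ g : G, P.IsPoissonMap (fun x : M ↦ g • x))
include hP

/-- As g is Poisson, Π♯(g^*a) at x equals T(g⁻¹) applied to Π♯a at g • x. That expression is jointly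
smooth by `contMDiff_mfderiv_param`, so g^*a need not be treated as a smooth family of sections. -/
lemma contMDiff_sharp_pullCovector_smul (a : OneForm E M) :
    ContMDiff (𝓘(ℝ, F).prod 𝓘(ℝ, E)) 𝓘(ℝ, E).tangent ∞
      (fun p : G × M ↦ (⟨p.2, P.sharp p.2 (pullCovector (fun y ↦ p.1 • y) a p.2)⟩ :
        TangentBundle 𝓘(ℝ, E) M)) := by
  have h1 : ContMDiff (𝓘(ℝ, F).prod 𝓘(ℝ, E)) 𝓘(ℝ, E).tangent ∞ (fun p : G × M ↦
      (⟨p.1⁻¹ • p.1 • p.2, mfderiv 𝓘(ℝ, E) 𝓘(ℝ, E) (fun y : M ↦ p.1⁻¹ • y) (p.1 • p.2)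
        (P.sharpForm a (p.1 • p.2))⟩ : TangentBundle 𝓘(ℝ, E) M)) :=
    contMDiff_mfderiv_param (m := fun p : G × M ↦ p.1 • p.2)
      (contMDiff_smul (I := 𝓘(ℝ, F)) (I' := 𝓘(ℝ, E)) (n := ∞))
      ((contMDiff_inv 𝓘(ℝ, F) ∞).comp contMDiff_fst)
      ((P.sharpForm a).contMDiff.comp (contMDiff_smul (I := 𝓘(ℝ, F)) (I' := 𝓘(ℝ, E)) (n := ∞)))
  refine h1.congr fun p ↦ ?_
  obtain ⟨g, x⟩ := p
  have h2 := (hP g).mfderiv_sharp x (a (g • x))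
  have h3 := mfderiv_comp (I := 𝓘(ℝ, E)) (I' := 𝓘(ℝ, E)) (I'' := 𝓘(ℝ, E)) x
    (((hP g⁻¹).1 (g • x)).mdifferentiableAt (by simp)) (((hP g).1 x).mdifferentiableAt (by simp))
  have h4 : (fun y : M ↦ g⁻¹ • y) ∘ (fun y : M ↦ g • y) = id := by
    funext y; simp
  rw [h4, mfderiv_id] at h3
  change (⟨x, P.sharp x (pullCovector (fun y ↦ g • y) a x)⟩ : TangentBundle 𝓘(ℝ, E) M) =
    ⟨g⁻¹ • g • x, mfderiv 𝓘(ℝ, E) 𝓘(ℝ, E) (fun y : M ↦ g⁻¹ • y) (g • x)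
        (P.sharp (g • x) (a (g • x)))⟩
  rw [← h2]
  have h5 := DFunLike.congr_fun h3 (P.sharp x (pullCovector (fun y ↦ g • y) a x))
  have h6 : ∀ (y z : M) (v w : E), y = z → v = w →
    (⟨y, v⟩ : TangentBundle 𝓘(ℝ, E) M) = ⟨z, w⟩ := by
    rintro y _ v _ rfl rfl; rfl
  exact h6 _ _ _ _ (inv_smul_smul g x).symm h5

variable (F) in
include F in
-- The derivative of g is an isomorphism intertwining Π♯, so it carries the identity wanted at x to
-- the frame identity at g • x.
lemma isDualFrame_pullCovector_smul {a b : ι → OneForm E M}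
    (h : IsDualFrame P (fun i x ↦ a i x) (fun i x ↦ b i x)) (g : G) :
    IsDualFrame P (fun i ↦ pullCovector (fun y ↦ g • y) (a i))
      (fun i ↦ pullCovector (fun y ↦ g • y) (b i)) where
  contMDiff_left i Y := (contMDiff_pullCovector_smul_apply (F := F) (G := G) (a i) Y).comp
    (f := fun x : M ↦ (g, x)) (contMDiff_const.prodMk contMDiff_id)
  contMDiff_right i Y := (contMDiff_pullCovector_smul_apply (F := F) (G := G) (b i) Y).comp
    (f := fun x : M ↦ (g, x)) (contMDiff_const.prodMk contMDiff_id)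
  locallyFinite x := by
    obtain ⟨J, hJ⟩ := h.locallyFinite (g • x)
    refine ⟨J, ?_⟩
    filter_upwards [((hP g).1 x).continuousAt.eventually hJ] with y hy i hi
    exact ⟨pullCovector_eq_zero (hy i hi).1, pullCovector_eq_zero (hy i hi).2⟩
  finsum_eq x γ := by
    let L := smulDeriv F (E := E) g x
    apply L.injective
    refine (AddMonoidHom.map_finsum_of_injective L.toLinearMap.toAddMonoidHom L.injective _).trans ?_
    let γ' : Cotangent E M (g • x) := γ.comp L.symm.toContinuousLinearMap
    have hγ' : γ'.comp (mfderiv 𝓘(ℝ, E) 𝓘(ℝ, E) (fun y : M ↦ g • y) x) = γ := by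
      ext v
      exact congrArg γ (L.symm_apply_apply v)
    have h1 : L (P.sharp x γ) = P.sharp (g • x) γ' := by
      rw [← (hP g).mfderiv_sharp x γ', hγ']
      rfl
    rw [h1, ← h.finsum_eq (g • x) γ']
    refine finsum_congr fun i ↦ ?_
    refine (map_smul L _ _).trans ?_
    have h2 := (hP g).mfderiv_sharp x (b i (g • x))
    rw [← h2, ← h1]
    rfl

lemma contMDiff_frameNabla_smul {a b : ι → OneForm E M}
    (h : IsDualFrame P (fun i x ↦ a i x) (fun i x ↦ b i x)) (X Y : LeafField P) :
    ContMDiff (𝓘(ℝ, F).prod 𝓘(ℝ, E)) 𝓘(ℝ, E).tangent ∞ (fun p : G × M ↦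
      (⟨p.2, frameNabla P (fun i ↦ pullCovector (fun y ↦ p.1 • y) (a i))
        (fun i ↦ pullCovector (fun y ↦ p.1 • y) (b i)) X Y p.2⟩ : TangentBundle 𝓘(ℝ, E) M)) := by
  have hd : ∀ c : OneForm E M, ContMDiff (𝓘(ℝ, F).prod 𝓘(ℝ, E)) 𝓘(ℝ, ℝ) ∞ (fun p : G × M ↦
      differential E (fun y ↦ pullCovector (fun y ↦ p.1 • y) c y (Y y)) p.2 (X p.2)) := fun c ↦
    contMDiff_differential_param (contMDiff_pullCovector_smul_apply (F := F) (G := G) c Y)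
      contMDiff_fst (X.contMDiff.comp contMDiff_snd)
  have hs := contMDiff_sharp_pullCovector_smul (F := F) hP
  rintro ⟨g₀, x₀⟩
  obtain ⟨J, hJ⟩ := h.locallyFinite (g₀ • x₀)
  have hcont : ContinuousAt (fun p : G × M ↦ p.1 • p.2) (g₀, x₀) :=
    (contMDiff_smul (I := 𝓘(ℝ, F)) (I' := 𝓘(ℝ, E)) (n := ∞)).continuous.continuousAt
  have hsnd : ContMDiffAt (𝓘(ℝ, F).prod 𝓘(ℝ, E)) 𝓘(ℝ, E) ∞ (Prod.snd : G × M → M) (g₀, x₀) :=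
    contMDiffAt_snd
  -- The inner sum over `Bool` writes the two summands of `derivTerm` as a linear combination, so
  -- that `contMDiffAt_sum_smul` applies twice.
  have key := contMDiffAt_sum_smul (n₀ := (g₀, x₀)) (κ := ι) (K := J) (c := fun _ _ ↦ (1 / 2 : ℝ))
    (w := fun i p ↦ ∑ k : Bool,
      cond k (differential E (fun y ↦ pullCovector (fun y ↦ p.1 • y) (a i) y (Y y)) p.2 (X p.2))
        (-differential E (fun y ↦ pullCovector (fun y ↦ p.1 • y) (b i) y (Y y)) p.2 (X p.2)) •
      cond k (P.sharp p.2 (pullCovector (fun y ↦ p.1 • y) (b i) p.2))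
        (P.sharp p.2 (pullCovector (fun y ↦ p.1 • y) (a i) p.2)))
    hsnd (fun _ _ ↦ contMDiffAt_const) fun i _ ↦
      contMDiffAt_sum_smul hsnd (fun k _ ↦ ?_) fun k _ ↦ ?_
  · refine key.congr_of_eventuallyEq ?_
    filter_upwards [hcont.eventually hJ] with p hp
    have hp' : ∀ i ∉ J, pullCovector (fun y ↦ p.1 • y) (a i) p.2 = 0 ∧
        pullCovector (fun y ↦ p.1 • y) (b i) p.2 = 0 := fun i hi ↦
      ⟨pullCovector_eq_zero (hp i hi).1, pullCovector_eq_zero (hp i hi).2⟩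
    rw [IsDualFrame.frameNabla_eq_sum hp', Finset.smul_sum]
    simp only [Fintype.sum_bool, derivTerm, cond_true, cond_false, neg_smul, sub_eq_add_neg]
  · cases k
    · exact (hd (b i)).neg _
    · exact hd (a i) _
  · cases k
    · exact hs (a i) _
    · exact hs (b i) _

end Action

/-! ### Averaging over the compact group -/

section Average

variable {F : Type*} [NormedAddCommGroup F] [NormedSpace ℝ F]
  {G : Type*} [TopologicalSpace G] [CompactSpace G] [ChartedSpace F G] [Group G]
  [LieGroup 𝓘(ℝ, F) ∞ G]
  {E : Type*} [NormedAddCommGroup E] [NormedSpace ℝ E] [FiniteDimensional ℝ E]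
  {M : Type*} [TopologicalSpace M] [T2Space M] [ChartedSpace E M] [IsManifold 𝓘(ℝ, E) ∞ M]
  [MulAction G M] [ContMDiffSMul 𝓘(ℝ, F) 𝓘(ℝ, E) ∞ G M]
  {ι : Type*} {P : Bivector E M}

/-- The value at `x` of the pull-back by `g` of the connection of a dual frame. -/
def translateNabla (P : Bivector E M) (a b : ι → OneForm E M) (X Y : LeafField P) (x : M)
    (g : G) : E :=
  frameNabla P (fun i ↦ pullCovector (fun y ↦ g • y) (a i))
    (fun i ↦ pullCovector (fun y ↦ g • y) (b i)) X Y x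

omit [CompactSpace G] in
variable (F) in
include F in
-- Pulling back by g and then by k is pulling back by g * k, so equivariance under k appears as
-- right translation in the integration variable.
lemma translateNabla_smul (hP : ∀ g : G, P.IsPoissonMap (fun x : M ↦ g • x))
    {a b : ι → OneForm E M} (h : IsDualFrame P (fun i x ↦ a i x) (fun i x ↦ b i x))
    {k : G} {X Y X' Y' : LeafField P} (hX : IsPushforward (fun x : M ↦ k • x) X X')
    (hY : IsPushforward (fun x : M ↦ k • x) Y Y') (x : M) (g : G) :
    translateNabla P a b X' Y' (k • x) g =
      smulDeriv F k x (translateNabla (E := E) P a b X Y x (g * k)) := by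
  have h1 := frameNabla_pushforward (hP k).1 (fun x ↦ (smulDeriv F (E := E) k x).injective)
    (hP k).mfderiv_sharp (isDualFrame_pullCovector_smul F hP h g) hX hY x
  have h2 : (fun y : M ↦ g • y) ∘ (fun y : M ↦ k • y) = fun y ↦ (g * k) • y := by
    funext y
    exact (mul_smul g k y).symm
  simp only [pullCovector_comp (hP g).1 (hP k).1, h2] at h1
  exact h1

omit [CompactSpace G] in
variable (F) in
include F in
lemma continuous_translateNabla (hP : ∀ g : G, P.IsPoissonMap (fun x : M ↦ g • x))
    {a b : ι → OneForm E M} (h : IsDualFrame P (fun i x ↦ a i x) (fun i x ↦ b i x))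
    (X Y : LeafField P) (x : M) :
    Continuous (translateNabla (G := G) P a b X Y x) := by
  have h1 := (contMDiff_frameNabla_smul (F := F) hP h X Y).continuous.comp
    (Continuous.prodMk_left (Y := M) (X := G) x)
  let e := trivializationAt E (TangentSpace 𝓘(ℝ, E) (M := M)) x
  have hx : x ∈ e.baseSet := mem_baseSet_trivializationAt E (TangentSpace 𝓘(ℝ, E) (M := M)) x
  have h2 : Continuous fun g : G ↦ (e ⟨x, translateNabla (E := E) P a b X Y x g⟩).2 :=
    continuous_snd.comp (e.continuousOn.comp_continuous h1 fun g ↦ e.mem_source.2 hx)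
  let L : E ≃L[ℝ] E := e.continuousLinearEquivAt ℝ x hx
  have h3 : Continuous fun g : G ↦ L (translateNabla P a b X Y x g) := h2
  exact (L.symm.continuous.comp h3).congr fun g ↦ L.symm_apply_apply _

variable (F) in
include F in
lemma exists_invariant_poissonConnection [T2Space G]
    (hP : ∀ g : G, P.IsPoissonMap (fun x : M ↦ g • x))
    {a b : ι → OneForm E M} (h : IsDualFrame P (fun i x ↦ a i x) (fun i x ↦ b i x)) :
    ∃ D : LeafConnection P, D.IsPoissonConnection ∧ D.IsInvariant G := by
  have := FiniteDimensional.proper_real E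
  have := topologicalGroup_of_lieGroup 𝓘(ℝ, F) ∞ (G := G)
  let _ : MeasurableSpace G := borel G
  have : BorelSpace G := ⟨rfl⟩
  -- Inverting the left Haar measure makes it right invariant, as `translateNabla_smul` requires.
  -- Total mass one makes affine identities survive integration.
  let μ : Measure G := (Measure.haarMeasure (⊤ : TopologicalSpace.PositiveCompacts G)).inv
  have hμ : IsProbabilityMeasure μ := ⟨by
    rw [Measure.inv_apply, inv_univ]
    exact Measure.haarMeasure_self⟩
  have hfr (g : G) := isDualFrame_pullCovector_smul F hP h g
  have hint (X Y : LeafField P) (x : M) : Integrable (translateNabla (G := G) P a b X Y x) μ :=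
    (continuous_translateNabla F hP h X Y x).integrable_of_hasCompactSupport
      (.of_compactSpace _)
  let avg (X Y : LeafField P) : LeafField P :=
    { toFun := fun x ↦ (∫ g : G, translateNabla P a b X Y x g ∂μ : E)
      contMDiff := contMDiff_integral_section (F := F) _ (contMDiff_frameNabla_smul hP h X Y)
      mem := fun x ↦ by
        -- A finite-dimensional subspace is closed and convex, hence contains averages of its
        -- elements.
        let p : Submodule ℝ E := P.leafTangent x
        change _ ∈ p
        exact p.convex.integral_mem p.closed_of_finiteDimensional
          (.of_forall fun g ↦ frameNabla_mem P _ _ X Y x) (hint X Y x) }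
  have havg (X Y : LeafField P) (x : M) :
    avg X Y x = (∫ g : G, translateNabla P a b X Y x g ∂μ : E) := rfl
  let D : LeafConnection P :=
    { nabla := avg
      add_left := fun X X' Y ↦ LeafField.ext <| funext fun x ↦ by
        refine Eq.trans (b := (∫ g : G, _ ∂μ : E)) ?_ (integral_add (hint X Y x) (hint X' Y x))
        exact integral_congr_ae (.of_forall fun g ↦ (hfr g).frameNabla_add_left X X' Y x)
      smul_left := fun f X Y ↦ LeafField.ext <| funext fun x ↦ by
        refine Eq.trans (b := (∫ g : G, _ ∂μ : E)) ?_
          (integral_smul (f x) (translateNabla (E := E) P a b X Y x))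
        exact integral_congr_ae (.of_forall fun g ↦ (hfr g).frameNabla_smul_left f X Y x)
      add_right := fun X Y Y' ↦ LeafField.ext <| funext fun x ↦ by
        refine Eq.trans (b := (∫ g : G, _ ∂μ : E)) ?_ (integral_add (hint X Y x) (hint X Y' x))
        exact integral_congr_ae (.of_forall fun g ↦ (hfr g).frameNabla_add_right X Y Y' x)
      leibniz := fun f X Y x ↦ by
        -- The inhomogeneous Leibniz term does not depend on g, so it integrates to itself.
        let w : E := differential E f x (X x) • Y x
        have h1 : (∫ g : G, translateNabla P a b X (f • Y) x g ∂μ) =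
            ∫ g : G, (f x • translateNabla P a b X Y x g + w) ∂μ :=
          integral_congr_ae (.of_forall fun g ↦ (hfr g).frameNabla_leibniz f X Y x)
        rw [integral_add (f := fun g ↦ f x • translateNabla P a b X Y x g) ((hint X Y x).smul (f x))
          (integrable_const w), integral_smul,
          integral_const, probReal_univ, one_smul] at h1
        exact h1 }
  refine ⟨D, fun X α β x ↦ ?_, fun k X Y X' Y' hX hY x ↦ ?_⟩
  · have h1 : (fun y ↦ α y (P.sharpForm β y)) = fun y ↦ -P.pairing y (α y) (β y) := by
      funext y
      exact P.antisymm y (β y) (α y)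
    have h2 : (fun y ↦ β y (P.sharpForm α y)) = fun y ↦ P.pairing y (α y) (β y) := rfl
    let α' : E →L[ℝ] ℝ := α x
    let β' : E →L[ℝ] ℝ := β x
    have h3 : β x (avg X (P.sharpForm α) x) - α x (avg X (P.sharpForm β) x) =
        differential E (fun y ↦ P.pairing y (α y) (β y)) x (X x) := by
      have hi1 := hint X (P.sharpForm α) x
      have hi2 := hint X (P.sharpForm β) x
      have e1 : β x (avg X (P.sharpForm α) x) =
          ∫ g, β' (translateNabla (G := G) P a b X (P.sharpForm α) x g) ∂μ :=
        (β'.integral_comp_comm hi1).symm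
      have e2 : α x (avg X (P.sharpForm β) x) =
          ∫ g, α' (translateNabla (G := G) P a b X (P.sharpForm β) x g) ∂μ :=
        (α'.integral_comp_comm hi2).symm
      rw [e1, e2, ← integral_sub (β'.integrable_comp hi1) (α'.integrable_comp hi2)]
      refine (integral_congr_ae (.of_forall fun g ↦ (hfr g).frameNabla_pairing X α β x)).trans ?_
      rw [integral_const, probReal_univ, one_smul]
    rw [LeafConnection.nablaBivector, LeafConnection.nablaForm, LeafConnection.nablaForm, h1, h2,
      differential_neg, ← h3]
    rw [_root_.neg_apply, ← h3]
    change _ - -(-_ - α x (avg X (P.sharpForm β) x)) - (_ - β x (avg X (P.sharpForm α) x)) = 0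
    ring
  · let L : E ≃L[ℝ] E := smulDeriv F k x
    have h1 : (∫ g, translateNabla P a b X' Y' (k • x) g ∂μ) =
        L (∫ g, translateNabla P a b X Y x g ∂μ) := by
      rw [← integral_mul_right_eq_self (μ := μ) (translateNabla P a b X Y x) k,
        ← L.integral_comp_comm]
      exact integral_congr_ae (.of_forall fun g ↦ translateNabla_smul F hP h hX hY x g)
    exact h1

end Average

/-! ### Smooth generalized inverses of maps of constant rank -/

section GeneralizedInverse

variable {V W : Type*} [NormedAddCommGroup V] [NormedSpace ℝ V] [FiniteDimensional ℝ V]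
  [NormedAddCommGroup W] [NormedSpace ℝ W] [FiniteDimensional ℝ W]

lemma exists_generalizedInverse (A : V →L[ℝ] W) : ∃ B : W →L[ℝ] V, ∀ v, A (B (A v)) = A v := by
  obtain ⟨g, hg⟩ := A.toLinearMap.rangeRestrict.exists_rightInverse_of_surjective
    A.toLinearMap.range_rangeRestrict
  obtain ⟨B, hB⟩ := LinearMap.exists_extend g
  refine ⟨LinearMap.toContinuousLinearMap B, fun v ↦ ?_⟩
  have h1 : B (A v) = g (A.toLinearMap.rangeRestrict v) :=
    LinearMap.congr_fun hB (A.toLinearMap.rangeRestrict v)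
  have h2 := LinearMap.congr_fun hg (A.toLinearMap.rangeRestrict v)
  have h3 := congrArg Subtype.val h2
  change A (B (A v)) = A v
  rw [h1]
  exact h3

omit [FiniteDimensional ℝ W] in
/-- A perturbation of constant rank of `A₀` has a generalized inverse depending rationally on the
perturbed map. -/
lemma generalizedInverse_perturb {A A₀ : V →L[ℝ] W} {B₀ : W →L[ℝ] V}
    (h₀ : ∀ v, A₀ (B₀ (A₀ v)) = A₀ v)
    (hrank : Module.finrank ℝ (LinearMap.range A.toLinearMap) =
      Module.finrank ℝ (LinearMap.range A₀.toLinearMap))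
    {S : V →L[ℝ] V} (hS : ∀ v, S (v + B₀ (A v - A₀ v)) = v) (v : V) :
    A (S (B₀ (A v))) = A v := by
  let T : V →ₗ[ℝ] V := LinearMap.id + B₀.toLinearMap ∘ₗ (A.toLinearMap - A₀.toLinearMap)
  have hT : ∀ v, T v = v + B₀ (A v - A₀ v) := fun _ ↦ rfl
  have hST : ∀ v, S (T v) = v := hS
  have hinj : Function.Injective T := Function.LeftInverse.injective hST
  -- If A k = 0 then T k = k - B₀ A₀ k, which A₀ kills. Equal ranks give kernels of equal dimension,
  -- so the inclusion is an equality; this is where constant rank enters.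
  have hker : (LinearMap.ker A.toLinearMap).map T = LinearMap.ker A₀.toLinearMap := by
    refine Submodule.eq_of_le_of_finrank_eq ?_ ?_
    · rintro _ ⟨k, hk, rfl⟩
      have hk' : A k = 0 := hk
      change A₀ (T k) = 0
      rw [hT, hk', zero_sub, map_neg, map_add, map_neg, h₀, add_neg_cancel]
    · rw [← (Submodule.equivMapOfInjective T hinj (LinearMap.ker A.toLinearMap)).finrank_eq]
      have h1 := A.toLinearMap.finrank_range_add_finrank_ker
      have h2 := A₀.toLinearMap.finrank_range_add_finrank_ker
      omega
  have hN : v - B₀ (A₀ v) ∈ LinearMap.ker A₀.toLinearMap := by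
    change A₀ (v - B₀ (A₀ v)) = 0
    rw [map_sub, h₀, sub_self]
  rw [← hker] at hN
  obtain ⟨k, hk, hkv⟩ := hN
  have hk' : A k = 0 := hk
  -- Applying S gives S B₀ A v = v - k with k in the kernel of A.
  have h1 : B₀ (A v) = T v - T k := by
    rw [hkv, hT, map_sub]
    abel
  rw [h1, map_sub, hST, hST, map_sub, hk', sub_zero]

variable {E : Type*} [NormedAddCommGroup E] [NormedSpace ℝ E]
  {M : Type*} [TopologicalSpace M] [ChartedSpace E M]

/-- The map T x = 1 + B₀ (A x - A x₀) is the identity at x₀, hence invertible nearby, and B x = (T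
x)⁻¹ B₀ is smooth because inversion is. -/
lemma exists_contMDiffOn_generalizedInverse {A : M → V →L[ℝ] W} {U₀ : Set M} (hU₀ : IsOpen U₀)
    (hA : ContMDiffOn 𝓘(ℝ, E) 𝓘(ℝ, V →L[ℝ] W) ∞ A U₀) {r : ℕ}
    (hr : ∀ x ∈ U₀, Module.finrank ℝ (LinearMap.range (A x).toLinearMap) = r)
    {x₀ : M} (hx₀ : x₀ ∈ U₀) :
    ∃ U : Set M, IsOpen U ∧ x₀ ∈ U ∧ U ⊆ U₀ ∧ ∃ B : M → W →L[ℝ] V,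
      ContMDiffOn 𝓘(ℝ, E) 𝓘(ℝ, W →L[ℝ] V) ∞ B U ∧ ∀ x ∈ U, ∀ v, A x (B x (A x v)) = A x v := by
  have : CompleteSpace V := FiniteDimensional.complete ℝ V
  obtain ⟨B₀, hB₀⟩ := exists_generalizedInverse (A x₀)
  let T : M → V →L[ℝ] V := fun x ↦ 1 + B₀.comp (A x - A x₀)
  have hT : ContMDiffOn 𝓘(ℝ, E) 𝓘(ℝ, V →L[ℝ] V) ∞ T U₀ :=
    contMDiffOn_const.add (contMDiffOn_const.clm_comp (hA.sub contMDiffOn_const))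
  refine ⟨U₀ ∩ T ⁻¹' {S | IsUnit S}, hT.continuousOn.isOpen_inter_preimage hU₀ Units.isOpen,
    ⟨hx₀, ?_⟩, inter_subset_left, fun x ↦ (Ring.inverse (T x)).comp B₀, ?_, ?_⟩
  · change IsUnit (T x₀)
    simp [T]
  · refine ContMDiffOn.clm_comp ?_ contMDiffOn_const
    intro x hx
    obtain ⟨u, hu⟩ : IsUnit (T x) := hx.2
    have h1 : ContDiffAt ℝ ∞ Ring.inverse (T x) := hu ▸ contDiffAt_ringInverse ℝ u
    exact h1.contMDiffAt.comp_contMDiffWithinAt x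
      ((hT x hx.1).mono inter_subset_left)
  · intro x hx v
    refine generalizedInverse_perturb hB₀ ((hr x hx.1).trans (hr x₀ hx₀).symm) (fun w ↦ ?_) v
    exact DFunLike.congr_fun (Ring.inverse_mul_cancel (T x) hx.2) w

end GeneralizedInverse

/-! ### Local dual frames -/

section LocalFrame

variable {E : Type*} [NormedAddCommGroup E] [NormedSpace ℝ E] [FiniteDimensional ℝ E]
  {M : Type*} [TopologicalSpace M] [ChartedSpace E M] [IsManifold 𝓘(ℝ, E) ∞ M]

/-- In a trivialization Π♯ becomes a map A of constant rank with generalized inverse B. The a_k are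
the coordinate forms and the b_k are the images under B of the basis vectors, so the identity is A B
A = A expanded in that basis. -/
lemma exists_local_dualFrame (P : Bivector E M) (hreg : P.IsRegular) (x₀ : M) :
    ∃ U : Set M, IsOpen U ∧ x₀ ∈ U ∧
      ∃ a b : Fin (Module.finrank ℝ E) → ∀ x : M, Cotangent E M x,
      (∀ k, ContMDiffOn 𝓘(ℝ, E) (𝓘(ℝ, E).prod 𝓘(ℝ, E →L[ℝ] ℝ)) ∞
        (fun x ↦ TotalSpace.mk' (E →L[ℝ] ℝ) (E := fun x : M ↦ Cotangent E M x) x (a k x)) U) ∧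
      (∀ k, ContMDiffOn 𝓘(ℝ, E) (𝓘(ℝ, E).prod 𝓘(ℝ, E →L[ℝ] ℝ)) ∞
        (fun x ↦ TotalSpace.mk' (E →L[ℝ] ℝ) (E := fun x : M ↦ Cotangent E M x) x (b k x)) U) ∧
      ∀ x ∈ U, ∀ γ : Cotangent E M x,
        ∑ k, a k x (P.sharp x γ) • P.sharp x (b k x) = P.sharp x γ := by
  obtain ⟨r, hr⟩ := hreg
  let e := trivializationAt E (fun x : M ↦ TangentSpace 𝓘(ℝ, E) x) x₀
  let c := trivializationAt (E →L[ℝ] ℝ) (fun x : M ↦ Cotangent E M x) x₀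
  let q := trivializationAt ((E →L[ℝ] ℝ) →L[ℝ] E)
    (fun x : M ↦ Cotangent E M x →L[ℝ] TangentSpace 𝓘(ℝ, E) x) x₀
  have hce : ∀ x ∈ e.baseSet, x ∈ c.baseSet := fun x hx ↦ ⟨hx, trivial⟩
  have hqe : ∀ x ∈ e.baseSet, x ∈ q.baseSet := fun x hx ↦ ⟨hce x hx, hx⟩
  have hx₀ : x₀ ∈ e.baseSet := mem_baseSet_trivializationAt E _ x₀
  let A : M → (E →L[ℝ] ℝ) →L[ℝ] E := fun x ↦ (q ⟨x, P.sharp x⟩).2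
  have hA : ContMDiffOn 𝓘(ℝ, E) 𝓘(ℝ, (E →L[ℝ] ℝ) →L[ℝ] E) ∞ A e.baseSet :=
    (q.contMDiffOn_section_iff (IB := 𝓘(ℝ, E)) e.open_baseSet fun x hx ↦ hqe x hx).1
      P.contMDiff_sharp.contMDiffOn
  have hAeq : ∀ x (hx : x ∈ e.baseSet), A x = (e.continuousLinearEquivAt ℝ x hx :
      TangentSpace 𝓘(ℝ, E) x →L[ℝ] E).comp ((P.sharp x).comp
        ((c.continuousLinearEquivAt ℝ x (hce x hx)).symm : (E →L[ℝ] ℝ) →L[ℝ] Cotangent E M x)) :=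
    fun x hx ↦ ContinuousLinearMap.inCoordinates_eq (hce x hx) hx
  have hArank : ∀ x ∈ e.baseSet, Module.finrank ℝ (LinearMap.range (A x).toLinearMap) = r := by
    intro x hx
    rw [← hr x, hAeq x hx]
    let Le := (e.continuousLinearEquivAt ℝ x hx).toLinearEquiv
    let Lc := (c.continuousLinearEquivAt ℝ x (hce x hx)).toLinearEquiv
    change Module.finrank ℝ (LinearMap.range
      (Le.toLinearMap ∘ₗ ((P.sharp x).toLinearMap ∘ₗ Lc.symm.toLinearMap))) = _
    rw [LinearMap.range_comp, LinearMap.range_comp_of_range_eq_top _ Lc.symm.range]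
    exact LinearEquiv.finrank_map_eq Le _
  obtain ⟨U, hU, hxU, hUe, B, hB, hAB⟩ :=
    exists_contMDiffOn_generalizedInverse e.open_baseSet hA hArank hx₀
  let v := Module.finBasis ℝ E
  let ε (k) : E →L[ℝ] ℝ := LinearMap.toContinuousLinearMap (v.coord k)
  refine ⟨U, hU, hxU, fun k x ↦ (ε k).comp (e.continuousLinearMapAt ℝ x),
    fun k x ↦ c.symmL ℝ x (B x (v k)), fun k ↦ ?_, fun k ↦ ?_, fun x hx γ ↦ ?_⟩
  · refine (c.contMDiffOn_section_iff (IB := 𝓘(ℝ, E)) hU fun x hx ↦ hce x (hUe hx)).2 ?_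
    refine (contMDiffOn_const (c := ε k)).congr fun x hx ↦ ?_
    ext w
    have := e.continuousLinearMapAt_symmL (R := ℝ) (hUe hx) w
    change (trivializationAt ℝ (Bundle.Trivial M ℝ) x₀).continuousLinearMapAt ℝ x
      (ε k (e.continuousLinearMapAt ℝ x (e.symmL ℝ x w))) = _
    rw [this]
    exact DFunLike.congr_fun
      (Bundle.Trivial.continuousLinearMapAt_trivialization ℝ M ℝ x) (ε k w)
  · refine (c.contMDiffOn_section_iff (IB := 𝓘(ℝ, E)) hU fun x hx ↦ hce x (hUe hx)).2 ?_
    refine (hB.clm_apply (contMDiffOn_const (c := v k))).congr fun x hx ↦ ?_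
    have := c.continuousLinearMapAt_symmL (R := ℝ) (hce x (hUe hx)) (B x (v k))
    rw [Trivialization.continuousLinearMapAt_apply,
      Trivialization.coe_linearMapAt_of_mem _ (hce x (hUe hx))] at this
    exact this
  · have hx' := hUe hx
    let Le := e.continuousLinearEquivAt ℝ x hx'
    let Lc := c.continuousLinearEquivAt ℝ x (hce x hx')
    have h1 : ∀ ξ, Le (P.sharp x (Lc.symm ξ)) = A x ξ := fun ξ ↦ by
      rw [hAeq x hx']; rfl
    have h2 : ∀ k, ((ε k).comp (e.continuousLinearMapAt ℝ x)) (P.sharp x γ) =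
        v.repr (Le (P.sharp x γ)) k := fun k ↦
      congrArg (ε k) (congrFun (e.coe_continuousLinearEquivAt_eq hx') _).symm
    have h3 : ∀ k, c.symmL ℝ x (B x (v k)) = Lc.symm (B x (v k)) := fun k ↦
      (congrFun (c.symm_continuousLinearEquivAt_eq (hce x hx')) _).symm
    apply Le.injective
    rw [map_sum]
    simp only [map_smul, h3, h1, h2]
    obtain ⟨ξ, rfl⟩ := Lc.symm.surjective γ
    rw [h1]
    conv_rhs => rw [← hAB x hx ξ, ← v.sum_repr (A x ξ), map_sum, map_sum]
    simp only [map_smul]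

end LocalFrame

/-! ### Global dual frames -/

section GlobalFrame

variable {E : Type*} [NormedAddCommGroup E] [NormedSpace ℝ E]
  {M : Type*} [TopologicalSpace M] [ChartedSpace E M] [IsManifold 𝓘(ℝ, E) ∞ M]

lemma contMDiff_oneForm_apply {P : Bivector E M} (α : OneForm E M) (Y : LeafField P) :
    ContMDiff 𝓘(ℝ, E) 𝓘(ℝ, ℝ) ∞ (fun x ↦ α x (Y x)) := by
  have h := ContMDiff.clm_bundle_apply (F₁ := E) (F₂ := ℝ)
    (E₁ := fun x : M ↦ TangentSpace 𝓘(ℝ, E) x) (E₂ := fun _ : M ↦ ℝ)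
    (b := fun x : M ↦ x) α.contMDiff Y.contMDiff
  exact fun x ↦ (contMDiffAt_totalSpace.1 (h x)).2

variable [FiniteDimensional ℝ E] [T2Space M] [SecondCountableTopology M]

lemma exists_dualFrame (P : Bivector E M) (hreg : P.IsRegular) :
    ∃ a b : M × Fin (Module.finrank ℝ E) → OneForm E M,
      IsDualFrame P (fun i x ↦ a i x) (fun i x ↦ b i x) := by
  have : LocallyCompactSpace M := ChartedSpace.locallyCompactSpace E M
  choose U hU hxU a b ha hb hab using exists_local_dualFrame P hreg
  obtain ⟨ρ, hρ⟩ := SmoothPartitionOfUnity.exists_isSubordinate 𝓘(ℝ, E) isClosed_univ U hU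
    fun x _ ↦ mem_iUnion.2 ⟨x, hxU x⟩
  -- The frame identity is bilinear in (a, b). Cutting off both factors by ρ gives weights ρ², whose
  -- sum σ is positive but need not be 1; it is divided out in b.
  let σ : M → ℝ := fun x ↦ ∑ᶠ i, ρ i x • ρ i x
  have hσ : ContMDiff 𝓘(ℝ, E) 𝓘(ℝ, ℝ) ∞ σ :=
    ρ.contMDiff_finsum_smul fun i x _ ↦ (ρ i).contMDiff x
  have hσfin : ∀ x, (Function.support fun i ↦ ρ i x • ρ i x).Finite := fun x ↦
    (ρ.locallyFinite.point_finite x).subset fun i hi h ↦ hi (by simp [h])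
  have hσpos : ∀ x, 0 < σ x := fun x ↦ by
    obtain ⟨i, hi⟩ := ρ.exists_pos_of_mem (mem_univ x)
    exact finsum_pos (fun j ↦ mul_self_nonneg _) ⟨i, mul_pos hi hi⟩ (hσfin x)
  have hσinv : ContMDiff 𝓘(ℝ, E) 𝓘(ℝ, ℝ) ∞ fun x ↦ (σ x)⁻¹ := fun x ↦
    (hσ x).inv₀ (hσpos x).ne'
  let a' : M × Fin (Module.finrank ℝ E) → OneForm E M := fun i ↦
    { toFun := fun x ↦ ρ i.1 x • a i.1 i.2 x
      contMDiff_toFun := ContMDiffOn.smul_section_of_tsupport (ρ i.1).contMDiff.contMDiffOn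
        (hU i.1) (hρ i.1) (ha i.1 i.2) }
  let b' : M × Fin (Module.finrank ℝ E) → OneForm E M := fun i ↦
    { toFun := fun x ↦ (σ x)⁻¹ • ρ i.1 x • b i.1 i.2 x
      contMDiff_toFun := hσinv.smul_section
        (ContMDiffOn.smul_section_of_tsupport (ρ i.1).contMDiff.contMDiffOn
          (hU i.1) (hρ i.1) (hb i.1 i.2)) }
  have ha' : ∀ i x, a' i x = ρ i.1 x • a i.1 i.2 x := fun _ _ ↦ rfl
  have hb' : ∀ i x, b' i x = (σ x)⁻¹ • ρ i.1 x • b i.1 i.2 x := fun _ _ ↦ rfl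
  refine ⟨a', b', fun i Y ↦ contMDiff_oneForm_apply (a' i) Y,
    fun i Y ↦ contMDiff_oneForm_apply (b' i) Y, fun x ↦ ?_, fun x γ ↦ ?_⟩
  · obtain ⟨t, ht, hfin⟩ := ρ.locallyFinite x
    refine ⟨hfin.toFinset ×ˢ Finset.univ, ?_⟩
    filter_upwards [ht] with y hy i hi
    have h0 : ρ i.1 y = 0 := by
      by_contra h
      exact hi (by simpa using ⟨y, h, hy⟩)
    rw [ha', hb', h0, zero_smul, zero_smul, smul_zero]
    exact ⟨rfl, rfl⟩
  · let J := (ρ.locallyFinite.point_finite x).toFinset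
    have hJ : ∀ i ∉ J, ρ i x = 0 := fun i hi ↦ by
      by_contra h
      exact hi (by simpa [J] using h)
    rw [finsum_eq_sum_of_support_subset (s := J ×ˢ Finset.univ)]
    · have hterm : ∀ i : M, ∑ k, a' (i, k) x (P.sharp x γ) • P.sharp x (b' (i, k) x) =
          ((σ x)⁻¹ * (ρ i x * ρ i x)) • P.sharp x γ := fun i ↦ by
        by_cases hi : x ∈ U i
        · rw [← hab i x hi γ, Finset.smul_sum]
          refine Finset.sum_congr rfl fun k _ ↦ ?_
          rw [ha', hb', map_smul, map_smul, _root_.smul_apply, hab i x hi γ]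
          simp only [smul_smul, smul_eq_mul]
          congr 1
          ring
        · have h0 : ρ i x = 0 := by
            by_contra h
            exact hi (hρ i (subset_tsupport _ h))
          simp [ha', h0]
      rw [Finset.sum_product]
      simp only [hterm]
      have hsum : σ x = ∑ i ∈ J, ρ i x * ρ i x :=
        finsum_eq_sum_of_support_subset _ fun i hi ↦ by
          by_contra h
          exact hi (by simp [hJ i h])
      rw [← Finset.sum_smul, ← Finset.mul_sum, ← hsum, inv_mul_cancel₀ (hσpos x).ne', one_smul]
    · intro i hi
      by_contra h
      have h0 : ρ i.1 x = 0 := hJ i.1 fun hJi ↦ h (by simpa using hJi)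
      exact hi (by simp [ha', h0])

end GlobalFrame

end RegularPoisson

end

theorem mainTheorem5
    {E : Type*} [NormedAddCommGroup E] [NormedSpace ℝ E] [FiniteDimensional ℝ E]
    {M : Type*} [TopologicalSpace M] [T2Space M] [SecondCountableTopology M]
    [ChartedSpace E M] [IsManifold 𝓘(ℝ, E) ∞ M]
    (P : RegularPoisson.Bivector E M) (hP : P.IsPoisson) (hreg : P.IsRegular) :
    (∃ D : RegularPoisson.LeafConnection P, D.IsPoissonConnection) ∧
    ∀ {F : Type*} [NormedAddCommGroup F] [NormedSpace ℝ F] [FiniteDimensional ℝ F]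
      {G : Type*} [TopologicalSpace G] [T2Space G] [CompactSpace G]
      [ChartedSpace F G] [Group G] [LieGroup 𝓘(ℝ, F) ∞ G]
      [MulAction G M] [ContMDiffSMul 𝓘(ℝ, F) 𝓘(ℝ, E) ∞ G M],
      (∀ g : G, P.IsPoissonMap (fun x : M ↦ g • x)) →
        ∃ D : RegularPoisson.LeafConnection P, D.IsPoissonConnection ∧ D.IsInvariant G := by
  obtain ⟨a, b, hab⟩ := RegularPoisson.exists_dualFrame P hreg
  refine ⟨?_, ?_⟩
  -- Without symmetry, the averaging result is applied to the one-point group acting trivially.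
  · let _ : MulAction PUnit.{1} M :=
      { smul := fun _ x ↦ x
        one_smul := fun _ ↦ rfl
        mul_smul := fun _ _ _ ↦ rfl }
    have : LieGroup 𝓘(ℝ, PUnit.{1}) ∞ PUnit.{1} :=
      { contMDiff_mul := contMDiff_const (c := PUnit.unit)
        contMDiff_inv := contMDiff_const (c := PUnit.unit) }
    have : ContMDiffSMul 𝓘(ℝ, PUnit.{1}) 𝓘(ℝ, E) ∞ PUnit.{1} M := ⟨contMDiff_snd⟩
    obtain ⟨D, hD, -⟩ := RegularPoisson.exists_invariant_poissonConnection PUnit.{1}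
      (G := PUnit.{1}) (fun _ ↦ ⟨contMDiff_id, fun _ _ _ _ ↦ rfl⟩) hab
    exact ⟨D, hD⟩
  · intro F _ _ _ G _ _ _ _ _ _ _ _ hG
    exact RegularPoisson.exists_invariant_poissonConnection F hG hab
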